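/- **Setting.** Let $K$ be an algebraically closed field, $Q$ a finite quiver with vertices $e_1,\dots,e_n$ (with paths composed so that $pq$ means "$p$ after $q$"), $I\subseteq KQ$ an admissible ideal, and $A=KQ/I$, with Jacobson radical $J$ and Loewy length $L+1$. Let $S_i=Ae_i/Je_i$. The radical layering of a finite dimensional left $A$-module $M$ is ${\mathbb S}(M)=(J^lM/J^{l+1}M)_{0\le l\le L}$, where isomorphic semisimple modules are identified. A top element of $M$ is an $x\in M\setminus JM$ with $e_ix=x$ for some $i$; a full sequence of top elements is one whose residue classes form a $K$-basis of $M/JM$. Fix a dimension vector $\mathbf d=(d_1,\dots,d_n)$, put $d=\sum_i d_i$, and let $\mathbf P=\bigoplus_{r=1}^{d}Az_r$ be the projective cover of $\bigoplus_i S_i^{d_i}$, where each $z_r$ is a top element normed by a vertex $e(r)$ (that is, $Az_r\cong Ae(r)$ via $z_r\leftrightarrow e(r)$). Let $\widehat{\mathbf P}=\bigoplus_{r=1}^{d}KQz_r$ be the corresponding projective $KQ$-module. A path in $\widehat{\mathbf P}$ is an element $pz_r$, where $p$ is a path of $Q$ starting in $e(r)$; its length is that of $p$, and its initial subpaths are the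 $qz_r$ with $p=uq$ for some path $u$. *Skeleta.* A skeleton (of dimension vector $\mathbf d$) is a set $\sigma$ of paths in $\widehat{\mathbf P}$ of lengths at most $L$, closed under initial subpaths, and containing exactly $d_i$ paths ending in $e_i$ for each $i$. Its radical layering is ${\mathbb S}(\sigma)=\bigl(\bigoplus_i S_i^{m(l,i)}\bigr)_{0\le l\le L}$, where $m(l,i)$ is the number of paths of length $l$ in $\sigma$ that end in $e_i$. More generally, let $\sigma$ be a finite set of paths in $\widehat{\mathbf P}$ (with ${\mathbb S}(\sigma)$ defined in the same way), and let $z_{i_1},\dots,z_{i_t}$ be the paths of length $0$ in $\sigma$. Then $\sigma$ is a skeleton of an $A$-module $M$ relative to a sequence $x_1,\dots,x_t$ in $M$ if ${\mathbb S}(M)={\mathbb S}(\sigma)$, the $x_s$ form a full sequence of top elements of $M$, and there is a $KQ$-epimorphism $f:\widehat{\mathbf P}\to M$ with $f(z_{i_s})=x_s$ for all $s$ such that $f(\sigma)$ is a $K$-basis of $M$. It is a skeleton of $M$ if this holds for some sequence. *The varieties.* For a skeleton $\sigma$, $\mathrm{GRASS}(\sigma)$ is the set of all $A$-submodules $C\subseteq\mathbf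 P$ such that $\mathbf P/C$ has dimension vector $\mathbf d$ and radical layering ${\mathbb S}(\sigma)$, and such that $\sigma$ is a skeleton of $\mathbf P/C$ relative to the distinguished sequence $z_{i_1}+C,\dots,z_{i_t}+C$. *Normalized skeleta.* The tree of $\sigma$ with root $z_r$ is the set of the paths in $\sigma$ that start in $z_r$. A skeleton $\sigma$ is normalized if it is a disjoint union $\sigma=\sigma_0\sqcup\sigma_1$ of trees, where all paths in $\sigma_0$ have length at most $1$, and each tree in $\sigma_1$ is a skeleton of an indecomposable projective module $Ae_i$ of Loewy length $3$. **Lemma 5.3.** Suppose that $A$ is self-injective with $J^3=0$, and let $\sigma$ and $\tau$ be normalized skeleta in $\widehat{\mathbf P}$ with ${\mathbb S}(\sigma)={\mathbb S}(\tau)$ such that $\mathrm{GRASS}(\sigma)$ and $\mathrm{GRASS}(\tau)$ are both nonempty. Then $\mathrm{GRASS}(\sigma)\cap\mathrm{GRASS}(\tau)\neq\varnothing$. In particular, some $A$-module, namely $\mathbf P/C$ for any $C$ in this intersection, has both $\sigma$ and $\tau$ as skeleta. -/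

import Mathlib

noncomputable section

namespace SkeletonGrass

universe u v w

section PathAlgebra

variable (K : Type u) [Field K] (V : Type v) [Quiver.{w} V]

/-- All paths of the quiver `V` (including the paths of length `0`), as triples
`(start, end, path)`. -/
abbrev AnyPath : Type max v w := Σ a b : V, Quiver.Path a b

/-- The path algebra `KQ`: the `K`-vector space with basis the paths of the quiver. Its product
is defined below, with the convention that `p * q` is "`p` after `q`". -/
def PathAlgebra : Type max u v w := AnyPath V →₀ K

namespace PathAlgebra

instance : AddCommGroup (PathAlgebra K V) := inferInstanceAs (AddCommGroup (AnyPath V →₀ K))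

instance : Module K (PathAlgebra K V) := inferInstanceAs (Module K (AnyPath V →₀ K))

variable {V}

/-- The paths form a `K`-basis of `KQ`. -/
def pathBasis : Module.Basis (AnyPath V) K (PathAlgebra K V) :=
  Module.Basis.ofRepr (LinearEquiv.refl K (AnyPath V →₀ K))

/-- The basis element of `KQ` given by a path. -/
def ofPath {a b : V} (p : Quiver.Path a b) : PathAlgebra K V := pathBasis K ⟨a, b, p⟩

/-- The coefficient of a path in an element of `KQ`. -/
def coeff {K : Type u} [Field K] (x : PathAlgebra K V) {a b : V} (p : Quiver.Path a b) : K :=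
  (pathBasis K).repr x ⟨a, b, p⟩

/-- The idempotent `e_i` of `KQ`: the path of length `0` at the vertex `i`. -/
def idem (i : V) : PathAlgebra K V := ofPath K (Quiver.Path.nil : Quiver.Path i i)

open Classical in
/-- The product of two paths: `p * q` is "`p` after `q`" if `q` ends where `p` starts, and `0`
otherwise. -/
def mulPath (p q : AnyPath V) : PathAlgebra K V :=
  if h : q.2.1 = p.1 then ofPath K (q.2.2.comp (p.2.2.cast h.symm rfl)) else 0

/-- The bilinear extension of the product of paths. -/
def mulMap : PathAlgebra K V →ₗ[K] PathAlgebra K V →ₗ[K] PathAlgebra K V :=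
  (pathBasis K).constr K (fun p => (pathBasis K).constr K (fun q => mulPath K p q))

instance : Mul (PathAlgebra K V) := ⟨fun x y => mulMap K x y⟩

/-- The identity of `KQ` is the sum of all paths of length `0`. -/
instance [Fintype V] : One (PathAlgebra K V) := ⟨∑ i : V, idem K i⟩

theorem mul_def (x y : PathAlgebra K V) : x * y = mulMap K x y := rfl

theorem one_def [Fintype V] : (1 : PathAlgebra K V) = ∑ i : V, idem K i := rfl

theorem ofPath_mul_ofPath' {a b c d : V} (p : Quiver.Path a b) (q : Quiver.Path c d) :
    ofPath K p * ofPath K q = mulPath K ⟨a, b, p⟩ ⟨c, d, q⟩ := by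
  rw [mul_def, mulMap, ofPath, ofPath, Module.Basis.constr_basis, Module.Basis.constr_basis]

theorem ofPath_mul_ofPath {a b c : V} (p : Quiver.Path b c) (q : Quiver.Path a b) :
    ofPath K p * ofPath K q = ofPath K (q.comp p) := by
  rw [ofPath_mul_ofPath', mulPath]
  simp

theorem ofPath_mul_ofPath_of_ne {a b c d : V} (p : Quiver.Path a b) (q : Quiver.Path c d)
    (h : d ≠ a) : ofPath K p * ofPath K q = 0 := by
  rw [ofPath_mul_ofPath', mulPath]
  simp [h]

theorem linear_ext {M : Type*} [AddCommGroup M] [Module K M] {f g : PathAlgebra K V →ₗ[K] M}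
    (h : ∀ (a b : V) (p : Quiver.Path a b), f (ofPath K p) = g (ofPath K p)) : f = g :=
  (pathBasis K).ext (fun x => h x.1 x.2.1 x.2.2)

theorem mul_assoc' (x y z : PathAlgebra K V) : x * y * z = x * (y * z) := by
  let F : PathAlgebra K V →ₗ[K] PathAlgebra K V →ₗ[K] PathAlgebra K V →ₗ[K] PathAlgebra K V :=
    (mulMap K).compr₂ (mulMap K)
  let G : PathAlgebra K V →ₗ[K] PathAlgebra K V →ₗ[K] PathAlgebra K V →ₗ[K] PathAlgebra K V :=
    ((LinearMap.llcomp K (PathAlgebra K V) (PathAlgebra K V) (PathAlgebra K V)) ∘ₗ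
      mulMap K).compl₂ (mulMap K)
  have hF : ∀ x y z, F x y z = x * y * z := fun x y z => rfl
  have hG : ∀ x y z, G x y z = x * (y * z) := fun x y z => rfl
  have : F = G := by
    refine linear_ext K fun a b p => linear_ext K fun c d q => linear_ext K fun e f r => ?_
    rw [hF, hG]
    by_cases h1 : d = a
    · subst h1
      rw [ofPath_mul_ofPath]
      by_cases h2 : f = c
      · subst h2
        rw [ofPath_mul_ofPath, ofPath_mul_ofPath, ofPath_mul_ofPath, Quiver.Path.comp_assoc]
      · rw [ofPath_mul_ofPath_of_ne K _ _ h2, ofPath_mul_ofPath_of_ne K _ _ h2, mul_def, map_zero]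
    · rw [ofPath_mul_ofPath_of_ne K _ _ h1]
      by_cases h2 : f = c
      · subst h2
        rw [ofPath_mul_ofPath, ofPath_mul_ofPath_of_ne K _ _ h1, mul_def, map_zero,
          LinearMap.zero_apply]
      · rw [ofPath_mul_ofPath_of_ne K _ _ h2, mul_def, mul_def, map_zero, map_zero,
          LinearMap.zero_apply]
  rw [← hF, ← hG, this]

theorem one_mul' [Fintype V] (x : PathAlgebra K V) : 1 * x = x := by
  classical
  have h : ∀ y z : PathAlgebra K V, mulMap K y z = y * z := fun _ _ => rfl
  have : mulMap K (1 : PathAlgebra K V) = LinearMap.id := by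
    refine linear_ext K fun a b p => ?_
    rw [one_def, map_sum, LinearMap.sum_apply, Finset.sum_eq_single b, h, idem,
      ofPath_mul_ofPath, Quiver.Path.comp_nil, LinearMap.id_apply]
    · intro i _ hi
      rw [h, idem, ofPath_mul_ofPath_of_ne K _ _ (Ne.symm hi)]
    · exact fun hb => absurd (Finset.mem_univ b) hb
  rw [mul_def, this, LinearMap.id_apply]

theorem mul_one' [Fintype V] (x : PathAlgebra K V) : x * 1 = x := by
  classical
  have h : ∀ y z : PathAlgebra K V, (mulMap K).flip y z = z * y := fun _ _ => rfl
  have : (mulMap K).flip (1 : PathAlgebra K V) = LinearMap.id := by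
    refine linear_ext K fun a b p => ?_
    rw [one_def, map_sum, LinearMap.sum_apply, Finset.sum_eq_single a, h, idem,
      ofPath_mul_ofPath, Quiver.Path.nil_comp, LinearMap.id_apply]
    · intro i _ hi
      rw [h, idem, ofPath_mul_ofPath_of_ne K _ _ hi]
    · exact fun hb => absurd (Finset.mem_univ a) hb
  rw [← h, this, LinearMap.id_apply]

instance [Fintype V] : Ring (PathAlgebra K V) :=
  { (inferInstance : AddCommGroup (PathAlgebra K V)),
    (inferInstance : Mul (PathAlgebra K V)),
    (inferInstance : One (PathAlgebra K V)) with
    mul_assoc := mul_assoc' K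
    one_mul := one_mul' K
    mul_one := mul_one' K
    left_distrib := fun x y z => by rw [mul_def, map_add]; rfl
    right_distrib := fun x y z => by rw [mul_def, map_add]; rfl
    zero_mul := fun x => by rw [mul_def, map_zero]; rfl
    mul_zero := fun x => by rw [mul_def, map_zero] }

instance [Fintype V] : Algebra K (PathAlgebra K V) :=
  Algebra.ofModule
    (fun c x y => by rw [mul_def, map_smul]; rfl)
    (fun c x y => by rw [mul_def, map_smul]; rfl)

end PathAlgebra

end PathAlgebra

/-- An ideal `I` of `KQ` is admissible if `(arrows)^N ⊆ I ⊆ (arrows)^2` for some `N`: every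
element of `I` is a combination of paths of length at least `2`, and `I` contains all
sufficiently long paths. -/
def IsAdmissible {K : Type u} [Field K] {V : Type v} [Quiver.{w} V] [Fintype V]
    (I : Ideal (PathAlgebra K V)) : Prop :=
  (∀ x ∈ I, ∀ (a b : V) (p : Quiver.Path a b), x.coeff p ≠ 0 → 2 ≤ p.length) ∧
    ∃ N : ℕ, ∀ (a b : V) (p : Quiver.Path a b), N ≤ p.length → PathAlgebra.ofPath K p ∈ I

section Modules

variable (A : Type*) [Ring A] (M : Type*) [AddCommGroup M] [Module A M]

/-- The submodule `J^l M`, where `J` is the Jacobson radical of `A`. -/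
def radPow : ℕ → Submodule A M
  | 0 => ⊤
  | l + 1 => Ring.jacobson A • radPow l

/-- The radical layer `J^l M / J^(l+1) M`. -/
abbrev RadLayer (l : ℕ) : Type _ := radPow A M l ⧸ (radPow A M (l + 1)).submoduleOf (radPow A M l)

/-- The Loewy length of `M`: the least `N` with `J^N M = 0`. -/
def loewyLength : ℕ := sInf {N : ℕ | radPow A M N = ⊥}

variable {A} in
/-- The subspace `e M` of `M`, for an (idempotent) element `e` of the `K`-algebra `A`. -/
def cornerSpace (K : Type*) [Field K] [Algebra K A] [Module K M] [IsScalarTower K A M] (e : A) :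
    Submodule K M :=
  LinearMap.range (Algebra.lsmul K K M e)

end Modules

section Skeleta

variable {K : Type u} [Field K] {V : Type v} [Quiver.{w} V]

/-- Let `z_1, …, z_n` be top elements, `z_r` being normed by the vertex `e r`. A path `p z_r`
in the projective `KQ`-module `P̂ = ⨁ KQ z_r` is a pair consisting of an index `r` and of a path
`p` of the quiver starting in `e r`. -/
abbrev FreePath {n : ℕ} (e : Fin n → V) : Type max v w := Σ (r : Fin n) (j : V), Quiver.Path (e r) j

namespace FreePath

variable {n : ℕ} {e : Fin n → V}

/-- The index `r` of the top element `z_r` in which the path `p z_r` starts. -/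
def root (b : FreePath e) : Fin n := b.1

/-- The end point of a path `p z_r`. -/
def target (b : FreePath e) : V := b.2.1

/-- The path `p` of the path `p z_r`. -/
def path (b : FreePath e) : Quiver.Path (e b.root) b.target := b.2.2

/-- The length of a path `p z_r`. -/
def length (b : FreePath e) : ℕ := b.path.length

/-- The top element `z_r` as a path of length `0`. -/
def top (e : Fin n → V) (r : Fin n) : FreePath e := ⟨r, e r, Quiver.Path.nil⟩

end FreePath

/-- The number `m(l, i)` of paths of length `l` ending in the vertex `i`, for a set `σ` of paths.
If `σ` is a skeleton, its radical layering `𝕊(σ)` is the sequence of the semisimple modules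
`⨁ i, S_i ^ m(l, i)`. -/
def layerCount [DecidableEq V] {n : ℕ} {e : Fin n → V} (σ : Finset (FreePath e)) (l : ℕ) (i : V) :
    ℕ :=
  (σ.filter (fun b => b.length = l ∧ b.target = i)).card

/-- The tree of `σ` with root `z_r`: the paths in `σ` which start in `z_r`. -/
def tree {n : ℕ} {e : Fin n → V} (σ : Finset (FreePath e)) (r : Fin n) : Finset (FreePath e) :=
  σ.filter (fun b => b.root = r)

/-- The direct sum `⨁ r, R z_r` of the left ideals `R ε_{e r}` of a ring `R`, where
`ε` is a family of idempotents of `R` indexed by the vertices. -/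
abbrev ProjSum {R : Type*} [Ring R] (ε : V → R) {n : ℕ} (e : Fin n → V) : Type _ :=
  (r : Fin n) → ↥(Ideal.span {ε (e r)} : Ideal R)

/-- The distinguished top element `z_r` of `⨁ r, R z_r`, normed by `ε_{e r}`. -/
def ProjSum.z {R : Type*} [Ring R] (ε : V → R) {n : ℕ} (e : Fin n → V) (r : Fin n) :
    ProjSum ε e :=
  Pi.single r ⟨ε (e r), Ideal.subset_span rfl⟩

variable [Fintype V]

variable (K) in
/-- The projective `KQ`-module `P̂ = ⨁ r, KQ z_r`, with `z_r` normed by `e r`. -/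
abbrev PHat {n : ℕ} (e : Fin n → V) : Type max u v w := ProjSum (PathAlgebra.idem K) e

/-- The element `p z_r` of `P̂`. -/
def FreePath.toPHat {n : ℕ} {e : Fin n → V} (b : FreePath e) : PHat K e :=
  PathAlgebra.ofPath K b.path • ProjSum.z (PathAlgebra.idem K) e b.root

variable (I : Ideal (PathAlgebra K V)) [I.IsTwoSided]

/-- The algebra `A = KQ / I`. -/
abbrev QuotAlg : Type max u v w := PathAlgebra K V ⧸ I

/-- The primitive idempotent `e_i` of `A = KQ / I`. -/
def vertexIdem (i : V) : QuotAlg I := Ideal.Quotient.mk I (PathAlgebra.idem K i)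

/-- The projective `A`-module `P = ⨁ r, A z_r`, with `z_r` normed by `e r`. -/
abbrev BigP {n : ℕ} (e : Fin n → V) : Type max u v w := ProjSum (vertexIdem I) e

/-- The distinguished top element `z_r` of `P`. -/
abbrev BigP.z {n : ℕ} (e : Fin n → V) (r : Fin n) : BigP I e := ProjSum.z (vertexIdem I) e r

/-- The indecomposable projective module `A e_i`. -/
abbrev IndecProj (i : V) : Type max u v w := ↥(Ideal.span {vertexIdem I i} : Ideal (QuotAlg I))

/-- A skeleton in `P̂` of dimension vector `d`, where `d i` is the number of the indices `r` with
`e r = i` (that is, `P` is the projective cover of `⨁ i, S_i ^ d i`): a set of paths in `P̂` of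
lengths at most `L`, where `L + 1` is the Loewy length of `A`, which is closed under initial
subpaths, and which contains precisely `d i` paths ending in the vertex `i`, for all `i`. -/
structure IsSkeleton [DecidableEq V] {n : ℕ} {e : Fin n → V} (σ : Finset (FreePath e)) : Prop where
  length_lt : ∀ b ∈ σ, b.length < loewyLength (QuotAlg I) (QuotAlg I)
  initial : ∀ (r : Fin n) (j k : V) (p₁ : Quiver.Path (e r) j) (p₂ : Quiver.Path j k),
    (⟨r, k, p₁.comp p₂⟩ : FreePath e) ∈ σ → (⟨r, j, p₁⟩ : FreePath e) ∈ σ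
  dim_eq : ∀ i : V, (σ.filter (fun b => b.target = i)).card =
    (Finset.univ.filter (fun r : Fin n => e r = i)).card

section ModuleNotions

variable (M : Type*) [AddCommGroup M] [Module (QuotAlg I) M]

/-- The dimension vector of a finite dimensional `A`-module `M`: its value in `i` is the
dimension of `e_i M`, that is, the multiplicity of the simple module `S_i` in `M`. -/
def dimVec [Module K M] [IsScalarTower K (QuotAlg I) M] (i : V) : ℕ :=
  Module.finrank K (cornerSpace M K (vertexIdem I i))

/-- `𝕊(M) = 𝕊(σ)`: for all `l` and `i`, the multiplicity of the simple module `S_i` in the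
semisimple module `J^l M / J^(l+1) M` is the number of paths in `σ` of length `l` ending
in `i`. -/
def HasLayering [DecidableEq V] [Module K M] [IsScalarTower K (QuotAlg I) M] {n : ℕ}
    {e : Fin n → V} (σ : Finset (FreePath e)) : Prop :=
  ∀ (l : ℕ) (i : V), dimVec I (RadLayer (QuotAlg I) M l) i = layerCount σ l i

variable {M}

/-- A top element of `M`: an element outside `J M` which is normed by some `e_i`. -/
def IsTopElement (x : M) : Prop :=
  x ∉ radPow (QuotAlg I) M 1 ∧ ∃ i : V, vertexIdem I i • x = x

/-- A full sequence of top elements of `M`: the residue classes form a `K`-basis of `M / J M`. -/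
def IsFullTopSequence [Module K M] [IsScalarTower K (QuotAlg I) M] {ι : Type*} (x : ι → M) : Prop :=
  (∀ s, IsTopElement I (x s)) ∧
    LinearIndependent K (fun s => (radPow (QuotAlg I) M 1).mkQ (x s)) ∧
    Submodule.span K (Set.range (fun s => (radPow (QuotAlg I) M 1).mkQ (x s))) = ⊤

/-- `σ` is a skeleton of `M` relative to the sequence `x` of elements of `M`, which is indexed
by the `r` with `z_r ∈ σ`. A `KQ`-linear map from `P̂` to the `A`-module `M` is a map that is
semilinear along the quotient map `KQ → A`. -/
structure IsSkeletonRel [DecidableEq V] [Module K M] [IsScalarTower K (QuotAlg I) M] {n : ℕ}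
    {e : Fin n → V} (σ : Finset (FreePath e)) (x : {r : Fin n // FreePath.top e r ∈ σ} → M) :
    Prop where
  layering : HasLayering I M σ
  full : IsFullTopSequence I x
  basis : ∃ f : PHat K e →ₛₗ[Ideal.Quotient.mk I] M, Function.Surjective f ∧
    (∀ r, f (ProjSum.z (PathAlgebra.idem K) e r.1) = x r) ∧
    LinearIndependent K (fun b : σ => f b.1.toPHat) ∧
    Submodule.span K (Set.range (fun b : σ => f b.1.toPHat)) = ⊤

variable (M)

/-- `σ` is a skeleton of `M`. -/
def IsSkeletonOf [DecidableEq V] [Module K M] [IsScalarTower K (QuotAlg I) M] {n : ℕ}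
    {e : Fin n → V} (σ : Finset (FreePath e)) : Prop :=
  ∃ x : {r : Fin n // FreePath.top e r ∈ σ} → M, IsSkeletonRel I σ x

end ModuleNotions

/-- A skeleton `σ` is normalized if it is a disjoint union `σ₀ ⊔ σ₁`, where `σ₀` consists of
trees with edge paths of lengths at most `1`, and `σ₁` consists of trees which are skeleta of
indecomposable projective modules of Loewy length `3`. Here `X` is the set of the roots of the
trees in `σ₁`. -/
def IsNormalized [DecidableEq V] {n : ℕ} {e : Fin n → V} (σ : Finset (FreePath e)) : Prop :=
  ∃ X : Set (Fin n),
    (∀ b ∈ σ, b.root ∉ X → b.length ≤ 1) ∧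
    ∀ r ∈ X, ∃ i : V, loewyLength (QuotAlg I) (IndecProj I i) = 3 ∧
      IsSkeletonOf I (IndecProj I i) (tree σ r)

/-- The points of the Grassmannian parametrizing the `A`-modules with dimension vector `d`, where
`d i` is the number of the `r` with `e r = i`: the `A`-submodules `C` of `P` such that `P / C` has
dimension vector `d`. -/
def grassDim [DecidableEq V] {n : ℕ} (e : Fin n → V) : Set (Submodule (QuotAlg I) (BigP I e)) :=
  {C | ∀ i : V, dimVec I (BigP I e ⧸ C) i = (Finset.univ.filter (fun r : Fin n => e r = i)).card}

/-- The points `C` parametrizing modules with radical layering `𝕊(σ)`. -/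
def grassLayering [DecidableEq V] {n : ℕ} {e : Fin n → V} (σ : Finset (FreePath e)) :
    Set (Submodule (QuotAlg I) (BigP I e)) :=
  {C | C ∈ grassDim I e ∧ HasLayering I (BigP I e ⧸ C) σ}

/-- `GRASS(σ)`: the points `C` with radical layering `𝕊(σ)` such that `σ` is a distinguished
skeleton of `P / C`, that is, a skeleton relative to the residue classes `z_r + C` of
the distinguished top elements `z_r ∈ σ`. -/
def grass [DecidableEq V] {n : ℕ} {e : Fin n → V} (σ : Finset (FreePath e)) :
    Set (Submodule (QuotAlg I) (BigP I e)) :=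
  {C | C ∈ grassLayering I σ ∧
    IsSkeletonRel I σ (fun r : {r : Fin n // FreePath.top e r ∈ σ} => C.mkQ (BigP.z I e r.1))}

end Skeleta

end SkeletonGrass

end

/-! The argument matches the two skeleta numerically and then finds a common module by a density
argument.

Matching: since $A$ is self-injective, a nonzero element of $e_jAe_i$ that is killed by $J$ on both
sides determines $i$ from $j$ (`vertex_eq_of_socle`). Because $J^3=0$, the paths of length 2 in a
tree of a projective $Ae_i$ of Loewy length 3 give such elements, and a normalized skeleton has no
other paths of length 2. So the second layer of ${\mathbb S}(\sigma)$ determines how many of these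
trees are rooted at each vertex (`NormalForm.card_filter_root_eq`). After subtracting the layers of
the projectives, the remaining paths of lengths 0 and 1 also agree in number at each end vertex
(`NormalForm.exists_restPath_equiv`).

Density: hence both skeleta can be realized on one vector space $(\bigoplus Ae_r)\oplus
K^\Theta\oplus K^B$, where $\Theta$ and $B$ index the remaining paths of lengths 0 and 1. Linear
forms $D$ on $A$ glue the last two summands into a module (`TwoLayer`), and $z_r$ is sent to
$g_r=(y_r,c_r,0)$. For given $(D,y,c)$, the elements $pg_r$ with $pz_r\in\sigma$ form a basis when a
determinant polynomial in $(D,y,c)$ does not vanish. `exists_point` supplies one good point for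
$\sigma$ and one for $\tau$. On the line joining them both determinants are nonzero polynomials in
one variable, and $K$ is infinite, so some point is good for both (`exists_common_point`).

Layering: $J^lM$ always lies in the part of degree at least $l$, which does not depend on $D$ and
has dimension at most the number of paths of length at least $l$. Conversely $pg_r\in
J^{\mathrm{length}(p)}M$. So a basis of this shape automatically spans each $J^lM$ by its paths of
length at least $l$ (`radPow_eq_span`), and the kernel of $\mathbf P\to M$ is the required $C$
(`ker_liftBigP_mem_grass`). -/

noncomputable section
namespace SkeletonGrass

universe u v w

/-! ### Coefficients and Jacobson radical of an admissible quotient of a path algebra -/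

section AdmissibleQuotient

variable {K : Type u} [Field K] {V : Type v} [Quiver.{w} V]

namespace PathAlgebra

/-- The coefficient of a path, as a linear form on `KQ`. -/
def coeffₗ {a b : V} (p : Quiver.Path a b) : PathAlgebra K V →ₗ[K] K :=
  (pathBasis K).coord ⟨a, b, p⟩

theorem coeffₗ_ofPath_self {a b : V} (p : Quiver.Path a b) :
    coeffₗ p (ofPath K p) = 1 := by
  simp [coeffₗ, ofPath]

theorem coeffₗ_ofPath_of_ne {a b c d : V} (p : Quiver.Path a b) (q : Quiver.Path c d)
    (h : (⟨c, d, q⟩ : AnyPath V) ≠ ⟨a, b, p⟩) : coeffₗ p (ofPath K q) = 0 := by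
  simp [coeffₗ, ofPath, h]

/-- The span of the paths of length at least `m`. -/
def lengthFiltration (K : Type u) [Field K] (V : Type v) [Quiver.{w} V] (m : ℕ) :
    Submodule K (PathAlgebra K V) :=
  Submodule.span K (pathBasis K '' {p : AnyPath V | m ≤ p.2.2.length})

theorem ofPath_mem_lengthFiltration {a b : V} (p : Quiver.Path a b) {m : ℕ} (h : m ≤ p.length) :
    ofPath K p ∈ lengthFiltration K V m :=
  Submodule.subset_span ⟨⟨a, b, p⟩, h, rfl⟩

theorem mem_lengthFiltration_iff {m : ℕ} {x : PathAlgebra K V} :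
    x ∈ lengthFiltration K V m ↔
      ∀ (a b : V) (p : Quiver.Path a b), x.coeff p ≠ 0 → m ≤ p.length := by
  rw [lengthFiltration, Module.Basis.mem_span_image]
  constructor
  · intro h a b p hp
    exact h (Finsupp.mem_support_iff.2 hp)
  · rintro h ⟨a, b, p⟩ hp
    exact h a b p (Finsupp.mem_support_iff.1 hp)

theorem mul_mem_lengthFiltration [Fintype V] {m k : ℕ} {x y : PathAlgebra K V}
    (hx : x ∈ lengthFiltration K V m) (hy : y ∈ lengthFiltration K V k) :
    x * y ∈ lengthFiltration K V (m + k) := by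
  induction hx using Submodule.span_induction with
  | zero => rw [zero_mul]; exact zero_mem _
  | add a b _ _ ha hb => rw [add_mul]; exact add_mem ha hb
  | smul c a _ ha => rw [smul_mul_assoc]; exact Submodule.smul_mem _ _ ha
  | mem x hx =>
    obtain ⟨⟨a, b, p⟩, hp, rfl⟩ := hx
    induction hy using Submodule.span_induction with
    | zero => rw [mul_zero]; exact zero_mem _
    | add a b _ _ ha hb => rw [mul_add]; exact add_mem ha hb
    | smul c a _ ha => rw [mul_smul_comm]; exact Submodule.smul_mem _ _ ha
    | mem y hy =>
      obtain ⟨⟨c, d, q⟩, hq, rfl⟩ := hy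
      change ofPath K p * ofPath K q ∈ _
      by_cases h : d = a
      · subst h
        rw [ofPath_mul_ofPath]
        refine ofPath_mem_lengthFiltration _ ?_
        simp only [Set.mem_ofPred_eq] at hp hq
        rw [Quiver.Path.length_comp]
        omega
      · rw [ofPath_mul_ofPath_of_ne K _ _ h]
        exact zero_mem _

theorem pow_mem_lengthFiltration [Fintype V] {x : PathAlgebra K V}
    (hx : x ∈ lengthFiltration K V 1) (k : ℕ) : x ^ k ∈ lengthFiltration K V k := by
  induction k with
  | zero => exact mem_lengthFiltration_iff.2 fun _ _ _ _ => Nat.zero_le _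
  | succ k ih => rw [pow_succ]; exact mul_mem_lengthFiltration ih hx

theorem idem_mul_ofPath [Fintype V] {a b : V} (p : Quiver.Path a b) :
    idem K b * ofPath K p = ofPath K p := by
  rw [idem, ofPath_mul_ofPath, Quiver.Path.comp_nil]

theorem ofPath_mul_idem [Fintype V] {a b : V} (p : Quiver.Path a b) :
    ofPath K p * idem K a = ofPath K p := by
  rw [idem, ofPath_mul_ofPath, Quiver.Path.nil_comp]

/-- A product of two paths is $e_i$ only if both factors are $e_i$. This is the character by which
the algebra acts on $S_i$. -/
theorem coeffₗ_nil_mul [Fintype V] (i : V) (x y : PathAlgebra K V) :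
    coeffₗ (Quiver.Path.nil : Quiver.Path i i) (x * y) =
      coeffₗ (Quiver.Path.nil : Quiver.Path i i) x *
        coeffₗ (Quiver.Path.nil : Quiver.Path i i) y := by
  let c : PathAlgebra K V →ₗ[K] K := coeffₗ (Quiver.Path.nil : Quiver.Path i i)
  let F : PathAlgebra K V →ₗ[K] PathAlgebra K V →ₗ[K] K := (mulMap K).compr₂ c
  let G : PathAlgebra K V →ₗ[K] PathAlgebra K V →ₗ[K] K := (LinearMap.mul K K).compl₁₂ c c
  suffices F = G from congrArg (fun H => H x y) this
  refine linear_ext K fun a b p => linear_ext K fun c' d q => ?_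
  change c (ofPath K p * ofPath K q) = c (ofPath K p) * c (ofPath K q)
  by_cases h : d = a
  · subst h
    rw [ofPath_mul_ofPath]
    rcases Nat.eq_zero_or_pos p.length with hp | hp
    · obtain rfl := Quiver.Path.eq_of_length_zero p hp
      obtain rfl := Quiver.Path.eq_nil_of_length_zero p hp
      rw [Quiver.Path.comp_nil]
      by_cases hi : d = i
      · subst hi
        rw [show c (ofPath K (Quiver.Path.nil : Quiver.Path d d)) = 1 from coeffₗ_ofPath_self _,
          one_mul]
      · rw [show c (ofPath K (Quiver.Path.nil : Quiver.Path d d)) = 0 from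
          coeffₗ_ofPath_of_ne _ _ fun h => hi (congrArg (fun z => z.1) h), zero_mul]
        refine coeffₗ_ofPath_of_ne _ _ fun h => hi (congrArg (fun z => z.2.1) h)
    · have key : ∀ (a : V) (p' : Quiver.Path a b), p'.length ≠ 0 → c (ofPath K p') = 0 :=
        fun a p' hp' => coeffₗ_ofPath_of_ne _ _ fun h =>
          hp' (congrArg (fun z : AnyPath V => z.2.2.length) h)
      rw [key _ _ hp.ne', key _ _ (by rw [Quiver.Path.length_comp]; omega), zero_mul]
  · rw [ofPath_mul_ofPath_of_ne K _ _ h, map_zero]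
    by_cases ha : (⟨a, b, p⟩ : AnyPath V) = ⟨i, i, Quiver.Path.nil⟩
    · rw [show c (ofPath K q) = 0 from coeffₗ_ofPath_of_ne _ _ fun hq => h
        ((congrArg (fun z : AnyPath V => z.2.1) hq).trans
          (congrArg (fun z : AnyPath V => z.1) ha).symm), mul_zero]
    · rw [show c (ofPath K p) = 0 from coeffₗ_ofPath_of_ne _ _ ha, zero_mul]

/-- A path $r$ of length 1 from $i$ to $j$ factors only as $e_j r$ or $r e_i$. The resulting
derivation rule is what later turns arrow coefficients into extensions of simple modules. -/
theorem coeffₗ_mul_of_length_eq_one [Fintype V] {i j : V} (r : Quiver.Path i j)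
    (hr : r.length = 1) (x y : PathAlgebra K V) :
    coeffₗ r (x * y) =
      coeffₗ (Quiver.Path.nil : Quiver.Path j j) x * coeffₗ r y +
        coeffₗ r x * coeffₗ (Quiver.Path.nil : Quiver.Path i i) y := by
  let c : PathAlgebra K V →ₗ[K] K := coeffₗ r
  let l : V → PathAlgebra K V →ₗ[K] K := fun i => coeffₗ (Quiver.Path.nil : Quiver.Path i i)
  let F : PathAlgebra K V →ₗ[K] PathAlgebra K V →ₗ[K] K := (mulMap K).compr₂ c
  let G : PathAlgebra K V →ₗ[K] PathAlgebra K V →ₗ[K] K :=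
    (LinearMap.mul K K).compl₁₂ (l j) c + (LinearMap.mul K K).compl₁₂ c (l i)
  suffices F = G from congrArg (fun H => H x y) this
  refine linear_ext K fun a b p => linear_ext K fun c' d q => ?_
  change c (ofPath K p * ofPath K q) =
    l j (ofPath K p) * c (ofPath K q) + c (ofPath K p) * l i (ofPath K q)
  have hc : ∀ {a b : V} (p : Quiver.Path a b), p.length ≠ 1 → c (ofPath K p) = 0 :=
    fun p hp => coeffₗ_ofPath_of_ne _ _ fun h =>
      hp ((congrArg (fun z : AnyPath V => z.2.2.length) h).trans hr)
  have hl : ∀ {a b : V} (k : V) (p : Quiver.Path a b), p.length ≠ 0 → l k (ofPath K p) = 0 :=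
    fun k p hp => coeffₗ_ofPath_of_ne _ _ fun h =>
      hp (congrArg (fun z : AnyPath V => z.2.2.length) h)
  have hs : ∀ {a b : V} (p : Quiver.Path a b), a ≠ i → c (ofPath K p) = 0 :=
    fun p hp => coeffₗ_ofPath_of_ne _ _ fun h => hp (congrArg (fun z : AnyPath V => z.1) h)
  have ht : ∀ {a b : V} (p : Quiver.Path a b), b ≠ j → c (ofPath K p) = 0 :=
    fun p hp => coeffₗ_ofPath_of_ne _ _ fun h => hp (congrArg (fun z : AnyPath V => z.2.1) h)
  have h1 : ∀ k, l k (ofPath K (Quiver.Path.nil : Quiver.Path k k)) = 1 :=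
    fun k => coeffₗ_ofPath_self _
  by_cases h : d = a
  · subst h
    rw [ofPath_mul_ofPath]
    rcases Nat.eq_zero_or_pos p.length with hp | hp
    · obtain rfl := Quiver.Path.eq_of_length_zero p hp
      obtain rfl := Quiver.Path.eq_nil_of_length_zero p hp
      rw [Quiver.Path.comp_nil, hc (Quiver.Path.nil : Quiver.Path d d) (by simp), zero_mul,
        add_zero]
      by_cases hd : d = j
      · subst hd
        rw [h1, one_mul]
      · rw [ht q hd, mul_zero]
    · rw [hl j p (by omega), zero_mul, zero_add]
      rcases Nat.eq_zero_or_pos q.length with hq | hq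
      · obtain rfl := Quiver.Path.eq_of_length_zero q hq
        obtain rfl := Quiver.Path.eq_nil_of_length_zero q hq
        rw [Quiver.Path.nil_comp]
        by_cases hd : c' = i
        · subst hd
          rw [h1, mul_one]
        · rw [hs p hd, zero_mul]
      · rw [hl i q (by omega), mul_zero, hc _ (by rw [Quiver.Path.length_comp]; omega)]
  · rw [ofPath_mul_ofPath_of_ne K _ _ h, map_zero]
    have e1 : l j (ofPath K p) * c (ofPath K q) = 0 := by
      by_cases hd : d = j
      · rw [show l j (ofPath K p) = 0 from coeffₗ_ofPath_of_ne _ _ fun h' =>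
          h (hd.trans (congrArg (fun z : AnyPath V => z.1) h').symm), zero_mul]
      · rw [ht q hd, mul_zero]
    have e2 : c (ofPath K p) * l i (ofPath K q) = 0 := by
      by_cases hd : a = i
      · rw [show l i (ofPath K q) = 0 from coeffₗ_ofPath_of_ne _ _ fun h' =>
          h ((congrArg (fun z : AnyPath V => z.2.1) h').trans hd.symm), mul_zero]
      · rw [hs p hd, zero_mul]
    rw [e1, e2, add_zero]

end PathAlgebra

open PathAlgebra

variable [Fintype V] {I : Ideal (PathAlgebra K V)} [I.IsTwoSided]

variable (I) in
/-- The class of a path in `A = KQ / I`. -/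
def pathClass {a b : V} (p : Quiver.Path a b) : QuotAlg I := Ideal.Quotient.mk I (ofPath K p)

theorem pathClass_comp {a b c : V} (p : Quiver.Path a b) (q : Quiver.Path b c) :
    pathClass I (p.comp q) = pathClass I q * pathClass I p := by
  rw [pathClass, pathClass, pathClass, ← map_mul, ofPath_mul_ofPath]

theorem vertexIdem_mul_pathClass {a b : V} (p : Quiver.Path a b) :
    vertexIdem I b * pathClass I p = pathClass I p := by
  rw [vertexIdem, pathClass, ← map_mul, idem_mul_ofPath]

theorem pathClass_mul_vertexIdem {a b : V} (p : Quiver.Path a b) :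
    pathClass I p * vertexIdem I a = pathClass I p := by
  rw [vertexIdem, pathClass, ← map_mul, ofPath_mul_idem]

theorem vertexIdem_mul_self (i : V) : vertexIdem I i * vertexIdem I i = vertexIdem I i :=
  pathClass_mul_vertexIdem _

theorem vertexIdem_mul_of_ne {i j : V} (h : i ≠ j) : vertexIdem I i * vertexIdem I j = 0 := by
  rw [vertexIdem, vertexIdem, ← map_mul, idem, idem, ofPath_mul_ofPath_of_ne K _ _ h.symm,
    map_zero]

theorem sum_vertexIdem : ∑ i : V, vertexIdem I i = 1 := by
  simp only [vertexIdem]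
  rw [← map_sum, ← PathAlgebra.one_def, map_one]

/-- The coefficient of a path of length at most `1`, as a linear form on `A = KQ / I`. -/
def lowCoeff (hI : IsAdmissible I) {a b : V} (p : Quiver.Path a b) (hp : p.length < 2) :
    QuotAlg I →ₗ[K] K :=
  -- Well defined on the quotient because elements of an admissible ideal involve only paths of
  -- length at least 2.
  (Submodule.liftQ (I.restrictScalars K) (coeffₗ p) (fun x hx => by
    by_contra h
    exact absurd (hI.1 x hx a b p h) (by omega))) ∘ₗ
    (Submodule.Quotient.restrictScalarsEquiv K I).symm.toLinearMap

/-- The coefficient of `e_i`, as a linear form on `A = KQ / I`. -/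
def vertexCoeff (hI : IsAdmissible I) (i : V) : QuotAlg I →ₗ[K] K :=
  lowCoeff hI (Quiver.Path.nil : Quiver.Path i i) (by simp)

variable (hI : IsAdmissible I)

theorem vertexCoeff_mul (i : V) (x y : QuotAlg I) :
    vertexCoeff hI i (x * y) = vertexCoeff hI i x * vertexCoeff hI i y := by
  obtain ⟨x, rfl⟩ := Ideal.Quotient.mk_surjective x
  obtain ⟨y, rfl⟩ := Ideal.Quotient.mk_surjective y
  rw [← map_mul]
  exact coeffₗ_nil_mul i x y

theorem vertexCoeff_vertexIdem_self (i : V) : vertexCoeff hI i (vertexIdem I i) = 1 :=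
  coeffₗ_ofPath_self _

theorem vertexCoeff_vertexIdem_of_ne {i j : V} (h : j ≠ i) :
    vertexCoeff hI i (vertexIdem I j) = 0 :=
  coeffₗ_ofPath_of_ne _ _ fun h' => h (congrArg (fun z : AnyPath V => z.1) h')

theorem vertexCoeff_pathClass_of_pos (i : V) {a b : V} (p : Quiver.Path a b) (hp : 0 < p.length) :
    vertexCoeff hI i (pathClass I p) = 0 :=
  coeffₗ_ofPath_of_ne _ _ fun h' =>
    hp.ne' (congrArg (fun z : AnyPath V => z.2.2.length) h')

theorem vertexCoeff_one (i : V) : vertexCoeff hI i 1 = 1 := by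
  classical
  rw [← sum_vertexIdem, map_sum, Finset.sum_eq_single i, vertexCoeff_vertexIdem_self]
  · exact fun j _ hj => vertexCoeff_vertexIdem_of_ne hI hj
  · simp

theorem lowCoeff_mul {i j : V} (p : Quiver.Path i j) (hp : p.length = 1) (x y : QuotAlg I) :
    lowCoeff hI p (by omega) (x * y) =
      vertexCoeff hI j x * lowCoeff hI p (by omega) y +
        lowCoeff hI p (by omega) x * vertexCoeff hI i y := by
  obtain ⟨x, rfl⟩ := Ideal.Quotient.mk_surjective x
  obtain ⟨y, rfl⟩ := Ideal.Quotient.mk_surjective y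
  rw [← map_mul]
  exact coeffₗ_mul_of_length_eq_one p hp x y

/-- A lift to $KQ$ involves only paths of positive length, so its $N$-th power involves only paths
of length at least $N$, all of which lie in $I$ for suitable $N$. -/
theorem isNilpotent_of_vertexCoeff_eq_zero {x : QuotAlg I} (hx : ∀ i, vertexCoeff hI i x = 0) :
    IsNilpotent x := by
  obtain ⟨x, rfl⟩ := Ideal.Quotient.mk_surjective x
  have h1 : x ∈ lengthFiltration K V 1 := by
    refine mem_lengthFiltration_iff.2 fun a b p hp => ?_
    by_contra h
    have h0 : p.length = 0 := by omega
    obtain rfl := Quiver.Path.eq_of_length_zero p h0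
    obtain rfl := Quiver.Path.eq_nil_of_length_zero p h0
    exact hp (hx a)
  obtain ⟨N, hN⟩ := hI.2
  refine ⟨N, ?_⟩
  rw [← map_pow, Ideal.Quotient.eq_zero_iff_mem]
  have h2 : lengthFiltration K V N ≤ I.restrictScalars K := by
    rw [lengthFiltration, Submodule.span_le]
    rintro _ ⟨⟨a, b, p⟩, hp, rfl⟩
    exact hN a b p hp
  exact h2 (pow_mem_lengthFiltration h1 N)

/-- The Jacobson radical of `KQ / I` is the common kernel of the vertex coefficients. -/
theorem mem_jacobson_iff_vertexCoeff {x : QuotAlg I} :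
    x ∈ Ring.jacobson (QuotAlg I) ↔ ∀ i, vertexCoeff hI i x = 0 := by
  rw [← Ideal.jacobson_bot, Ideal.mem_jacobson_iff]
  constructor
  · intro h i
    by_contra hc
    -- The scalar is chosen so that $1-c^{-1}x$ has vanishing coefficient at $e_i$, which excludes a
    -- left inverse $z$.
    obtain ⟨z, hz⟩ := h (algebraMap K _ (-(vertexCoeff hI i x)⁻¹))
    have h2 := congrArg (vertexCoeff hI i) ((Submodule.mem_bot _).1 hz)
    rw [map_sub, map_add, map_zero, mul_assoc, vertexCoeff_mul, ← Algebra.smul_def, map_smul,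
      vertexCoeff_one, smul_eq_mul, neg_mul, inv_mul_cancel₀ hc] at h2
    simp at h2
  · intro h y
    have hn : IsNilpotent (y * x) := isNilpotent_of_vertexCoeff_eq_zero hI fun i => by
      rw [vertexCoeff_mul, h, mul_zero]
    obtain ⟨u, hu⟩ := hn.isUnit_one_add
    refine ⟨(u⁻¹ : (QuotAlg I)ˣ), ?_⟩
    have : (↑u⁻¹ : QuotAlg I) * (1 + y * x) = 1 := by rw [← hu, Units.inv_mul]
    rw [Submodule.mem_bot, mul_assoc]
    rw [mul_add, mul_one] at this
    rw [← this]
    abel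

theorem pathClass_mem_jacobson (hI : IsAdmissible I) {a b : V} (p : Quiver.Path a b) (hp : 0 < p.length) :
    pathClass I p ∈ Ring.jacobson (QuotAlg I) :=
  (mem_jacobson_iff_vertexCoeff hI).2 fun i => vertexCoeff_pathClass_of_pos hI i p hp

/-- Modulo $J$ the algebra is spanned by the $e_i$. Hence on elements killed by $J$, multiplication
is governed by vertex coefficients alone. -/
theorem sub_sum_vertexCoeff_mem_jacobson (x : QuotAlg I) :
    x - ∑ i, vertexCoeff hI i x • vertexIdem I i ∈ Ring.jacobson (QuotAlg I) := by
  classical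
  refine (mem_jacobson_iff_vertexCoeff hI).2 fun i => ?_
  rw [map_sub, map_sum, Finset.sum_eq_single i, map_smul, vertexCoeff_vertexIdem_self,
    smul_eq_mul, mul_one, sub_self]
  · intro j _ hj
    rw [map_smul, vertexCoeff_vertexIdem_of_ne hI hj, smul_zero]
  · simp

theorem pathClass_smul_mem_radPow (hI : IsAdmissible I) {M : Type*} [AddCommGroup M]
    [Module (QuotAlg I) M] {a b : V} (p : Quiver.Path a b) (x : M) :
    pathClass I p • x ∈ radPow (QuotAlg I) M p.length := by
  induction p with
  | nil => trivial
  | cons p α ih =>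
    have h : pathClass I (p.cons α) = pathClass I α.toPath * pathClass I p :=
      pathClass_comp p α.toPath
    rw [h, mul_smul]
    exact Submodule.smul_mem_smul (pathClass_mem_jacobson hI _ (by simp)) ih

end AdmissibleQuotient

/-! ### Bases adapted to the radical filtration -/

section RadicalFiltration

theorem eq_zero_of_sum_mem_span_image {K M ι : Type*} [Field K] [AddCommGroup M] [Module K M]
    {v : ι → M} (hv : LinearIndependent K v) {p : ι → Prop} {t : Set ι} (hpt : ∀ b ∈ t, ¬ p b)
    [Fintype {b // p b}] {c : {b // p b} → K}
    (h : ∑ b, c b • v b ∈ Submodule.span K (v '' t)) : c = 0 := by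
  have h1 : ∑ b, c b • v b ∈ Submodule.span K (v '' {b | p b}) :=
    Submodule.sum_mem _ fun b _ => Submodule.smul_mem _ _ (Submodule.subset_span ⟨b, b.2, rfl⟩)
  have hd : Disjoint {b | p b} t := Set.disjoint_left.2 fun b hb hb' => hpt b hb' hb
  have h2 := Submodule.disjoint_def.1 (hv.disjoint_span_image hd) _ h1 h
  exact funext fun b => Fintype.linearIndependent_iff.1 (hv.comp _ Subtype.val_injective) c h2 b

variable {K : Type*} [Field K] {A : Type*} [Ring A] [Algebra K A]
variable {M : Type*} [AddCommGroup M] [Module A M] [Module K M] [IsScalarTower K A M]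

theorem radPow_succ_le (l : ℕ) : radPow A M (l + 1) ≤ radPow A M l := by
  change Ring.jacobson A • radPow A M l ≤ _
  exact Submodule.smul_le.2 fun _ _ _ hm => Submodule.smul_mem _ _ hm

theorem radPow_antitone : Antitone (radPow A M) := antitone_nat_of_succ_le radPow_succ_le

theorem map_radPow {N : Type*} [AddCommGroup N] [Module A N] {f : M →ₗ[A] N}
    (hf : Function.Surjective f) (l : ℕ) : (radPow A M l).map f = radPow A N l := by
  induction l with
  | zero => exact (Submodule.map_top f).trans (LinearMap.range_eq_top.2 hf)
  | succ l ih =>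
    change Submodule.map f (Ring.jacobson A • radPow A M l) = Ring.jacobson A • radPow A N l
    rw [Submodule.map_smul'', ih]

theorem map_radPow_le {N : Type*} [AddCommGroup N] [Module A N] (f : M →ₗ[A] N) (l : ℕ) :
    (radPow A M l).map f ≤ radPow A N l := by
  induction l with
  | zero => exact le_top
  | succ l ih =>
    change Submodule.map f (Ring.jacobson A • radPow A M l) ≤ Ring.jacobson A • radPow A N l
    rw [Submodule.map_smul'']
    exact Submodule.smul_mono (le_refl _) ih

variable {ι : Type*} {v : ι → M} {len : ι → ℕ}

/-- A linearly independent family which is compatible with the radical filtration and which is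
large enough in each degree yields bases of all terms of the radical filtration. -/
theorem radPow_eq_span [Finite ι] [Module.Finite K M] (hv : LinearIndependent K v)
    (hmem : ∀ b, v b ∈ radPow A M (len b))
    (hdim : ∀ l, Module.finrank K (radPow A M l) ≤ Nat.card {b // l ≤ len b}) (l : ℕ) :
    (radPow A M l).restrictScalars K = Submodule.span K (v '' {b | l ≤ len b}) := by
  symm
  -- The family gives one inclusion and the assumed dimension bound gives equality, so an upper
  -- bound on $\dim J^lM$ is enough.
  apply Submodule.eq_of_le_of_finrank_le
  · rw [Submodule.span_le]
    rintro _ ⟨b, hb, rfl⟩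
    exact radPow_antitone hb (hmem b)
  · have := Fintype.ofFinite ι
    classical
    have h : LinearIndependent K (fun b : {b // l ≤ len b} => v b) :=
      hv.comp _ Subtype.val_injective
    have h2 := finrank_span_eq_card h
    have h3 : Set.range (fun b : {b // l ≤ len b} => v b) = v '' {b | l ≤ len b} := by
      ext x; simp
    rw [h3] at h2
    rw [h2, ← Nat.card_eq_fintype_card]
    exact hdim l

theorem linearIndependent_mkQ_of {κ : Type*} [Fintype κ] {w : κ → M} (N : Submodule A M)
    (h : ∀ c : κ → K, ∑ b, c b • w b ∈ N → c = 0) :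
    LinearIndependent K (fun b => N.mkQ (w b)) := by
  refine Fintype.linearIndependent_iff.2 fun c hc => congrFun (h c ?_)
  have : (N.mkQ.restrictScalars K) (∑ b, c b • w b) = 0 := by
    rw [map_sum, ← hc]
    exact Finset.sum_congr rfl fun b _ => map_smul (N.mkQ.restrictScalars K) _ _
  exact (Submodule.Quotient.mk_eq_zero N).1 this

section Layers

variable (hv : LinearIndependent K v)
  (hspan : ∀ l, (radPow A M l).restrictScalars K = Submodule.span K (v '' {b | l ≤ len b}))

include hspan in
theorem mem_radPow_of_span (b : ι) : v b ∈ radPow A M (len b) := by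
  have : v b ∈ (radPow A M (len b)).restrictScalars K := by
    rw [hspan]
    exact Submodule.subset_span ⟨b, le_refl (len b), rfl⟩
  exact this

include hspan in
theorem radLayer_mem_radPow {l : ℕ} (b : {b // len b = l}) : v b ∈ radPow A M l := by
  have := mem_radPow_of_span hspan b.1
  rwa [b.2] at this

include hv hspan in
theorem linearIndependent_radLayer [Finite ι] (l : ℕ) :
    LinearIndependent K (fun b : {b // len b = l} =>
      ((radPow A M (l + 1)).submoduleOf (radPow A M l)).mkQ
        ⟨v b, radLayer_mem_radPow hspan b⟩) := by
  have := Fintype.ofFinite {b // len b = l}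
  refine linearIndependent_mkQ_of _ fun c hc => ?_
  have hc' : ∑ b : {b // len b = l}, c b • v b ∈ (radPow A M (l + 1)).restrictScalars K := by
    have h2 := Submodule.mem_comap.1 hc
    rw [Submodule.subtype_apply, AddSubmonoidClass.coe_finsetSum] at h2
    exact h2
  rw [hspan] at hc'
  refine eq_zero_of_sum_mem_span_image hv (fun b hb h => ?_) hc'
  have hb' : l + 1 ≤ len b := hb
  omega

include hspan in
theorem span_radLayer (l : ℕ) :
    Submodule.span K (Set.range (fun b : {b // len b = l} =>
      ((radPow A M (l + 1)).submoduleOf (radPow A M l)).mkQ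
        ⟨v b, radLayer_mem_radPow hspan b⟩)) = ⊤ := by
  rw [eq_top_iff]
  rintro x -
  obtain ⟨⟨x, hx⟩, rfl⟩ := Submodule.mkQ_surjective _ x
  have hx' : x ∈ (radPow A M l).restrictScalars K := hx
  rw [hspan] at hx'
  induction hx' using Submodule.span_induction with
  | zero => exact zero_mem _
  | smul c a ha ih =>
    have ha' : a ∈ (radPow A M l).restrictScalars K := by rw [hspan]; exact ha
    exact Submodule.smul_mem _ c (ih ha')
  | add a b ha hb iha ihb =>
    have ha' : a ∈ (radPow A M l).restrictScalars K := by rw [hspan]; exact ha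
    have hb' : b ∈ (radPow A M l).restrictScalars K := by rw [hspan]; exact hb
    exact Submodule.add_mem _ (iha ha') (ihb hb')
  | mem a ha =>
    obtain ⟨b, hb, rfl⟩ := ha
    rcases Nat.lt_or_ge l (len b) with h | h
    · have h0 : ((radPow A M (l + 1)).submoduleOf (radPow A M l)).mkQ ⟨v b, hx⟩ = 0 := by
        rw [Submodule.mkQ_apply, Submodule.Quotient.mk_eq_zero]
        exact radPow_antitone h (mem_radPow_of_span hspan b)
      rw [h0]
      exact zero_mem _
    · exact Submodule.subset_span ⟨⟨b, le_antisymm h hb⟩, rfl⟩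

include hv hspan in
theorem linearIndependent_top [Finite ι] : LinearIndependent K (fun b : {b // len b = 0} =>
    (radPow A M 1).mkQ (v b)) := by
  have := Fintype.ofFinite {b // len b = 0}
  refine linearIndependent_mkQ_of _ fun c hc => ?_
  have hc' : ∑ b : {b // len b = 0}, c b • v b ∈ (radPow A M 1).restrictScalars K := hc
  rw [hspan] at hc'
  refine eq_zero_of_sum_mem_span_image hv (fun b hb h => ?_) hc'
  have hb' : 1 ≤ len b := hb
  omega

include hspan in
theorem span_top : Submodule.span K (Set.range (fun b : {b // len b = 0} =>
    (radPow A M 1).mkQ (v b))) = ⊤ := by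
  rw [eq_top_iff]
  rintro x -
  obtain ⟨x, rfl⟩ := Submodule.mkQ_surjective _ x
  have hx' : x ∈ (radPow A M 0).restrictScalars K := trivial
  rw [hspan] at hx'
  induction hx' using Submodule.span_induction with
  | zero => exact zero_mem _
  | smul c a ha ih => exact Submodule.smul_mem _ c ih
  | add a b ha hb iha ihb => rw [map_add]; exact Submodule.add_mem _ iha ihb
  | mem a ha =>
    obtain ⟨b, hb, rfl⟩ := ha
    rcases Nat.eq_zero_or_pos (len b) with h | h
    · exact Submodule.subset_span ⟨⟨b, h⟩, rfl⟩
    · have h0 : (radPow A M 1).mkQ (v b) = 0 := by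
        rw [Submodule.mkQ_apply, Submodule.Quotient.mk_eq_zero]
        exact radPow_antitone (a := 1) h (mem_radPow_of_span hspan b)
      rw [h0]
      exact zero_mem _

end Layers

end RadicalFiltration

/-! ### A criterion for being a skeleton -/

section Criterion

theorem FreePath.eq_top_of_length_eq_zero {V : Type v} [Quiver.{w} V] {n : ℕ} {e : Fin n → V} {b : FreePath e}
    (h : b.length = 0) : b = FreePath.top e b.root := by
  obtain ⟨r, j, p⟩ := b
  have hp : p.length = 0 := h
  obtain rfl := Quiver.Path.eq_of_length_zero p hp
  obtain rfl := Quiver.Path.eq_nil_of_length_zero p hp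
  rfl

variable {K : Type u} [Field K] {V : Type v} [Quiver.{w} V] [Fintype V]
  {I : Ideal (PathAlgebra K V)} [I.IsTwoSided]
variable {M : Type*} [AddCommGroup M] [Module (QuotAlg I) M]

theorem vertexIdem_smul_pathClass_smul {a b : V} (p : Quiver.Path a b) (x : M) :
    vertexIdem I b • pathClass I p • x = pathClass I p • x := by
  rw [← mul_smul, vertexIdem_mul_pathClass]

theorem vertexIdem_smul_of_ne {i j : V} (h : i ≠ j) {x : M} (hx : vertexIdem I j • x = x) :
    vertexIdem I i • x = 0 := by
  rw [← hx, ← mul_smul, vertexIdem_mul_of_ne h, zero_smul]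

variable (I) in
/-- The `KQ`-linear map from `P̂` to an `A`-module which sends `z_r` to `x_r`. -/
def liftPHat {n : ℕ} (e : Fin n → V) (x : Fin n → M) : PHat K e →ₛₗ[Ideal.Quotient.mk I] M where
  toFun p := ∑ r, Ideal.Quotient.mk I (p r : PathAlgebra K V) • x r
  map_add' p q := by
    rw [← Finset.sum_add_distrib]
    exact Finset.sum_congr rfl fun r _ => by
      rw [Pi.add_apply, Submodule.coe_add, map_add, add_smul]
  map_smul' a p := by
    rw [Finset.smul_sum]
    exact Finset.sum_congr rfl fun r _ => by
      rw [Pi.smul_apply, Submodule.coe_smul, smul_eq_mul, map_mul, mul_smul]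

theorem liftPHat_z {n : ℕ} (e : Fin n → V) (x : Fin n → M) (r : Fin n) :
    liftPHat I e x (ProjSum.z (PathAlgebra.idem K) e r) = vertexIdem I (e r) • x r := by
  change ∑ s, Ideal.Quotient.mk I
    (ProjSum.z (PathAlgebra.idem K) e r s : PathAlgebra K V) • x s = _
  rw [Finset.sum_eq_single r]
  · simp [ProjSum.z, vertexIdem]
  · intro s _ hs
    simp [ProjSum.z, hs]
  · simp

theorem semilinear_toPHat {n : ℕ} {e : Fin n → V} (f : PHat K e →ₛₗ[Ideal.Quotient.mk I] M)
    (b : FreePath e) : f b.toPHat =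
      pathClass I b.path • f (ProjSum.z (PathAlgebra.idem K) e b.root) :=
  map_smulₛₗ f _ _

variable (I) in
/-- The elements `p x_r` with `p z_r ∈ σ`. -/
def pathFamily {n : ℕ} {e : Fin n → V} (σ : Finset (FreePath e)) (x : Fin n → M) (b : σ) : M :=
  pathClass I b.1.path • x b.1.root

theorem pathFamily_apply {n : ℕ} {e : Fin n → V} (σ : Finset (FreePath e)) (x : Fin n → M)
    (b : σ) : pathFamily I σ x b = pathClass I b.1.path • x b.1.root := rfl

variable [Module K M] [IsScalarTower K (QuotAlg I) M]

/-- The dimension vector, computed from a basis of elements which are normed by vertices. -/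
theorem dimVec_eq_card {ι : Type*} [Finite ι] {v : ι → M} (hv : LinearIndependent K v)
    (hspan : Submodule.span K (Set.range v) = ⊤) (t : ι → V)
    (ht : ∀ b, vertexIdem I (t b) • v b = v b) (i : V) :
    dimVec I M i = Nat.card {b // t b = i} := by
  have := Fintype.ofFinite {b // t b = i}
  have h : cornerSpace M K (vertexIdem I i) =
      Submodule.span K (Set.range fun b : {b // t b = i} => v b) := by
    apply le_antisymm
    · rintro _ ⟨x, rfl⟩
      have hx : x ∈ Submodule.span K (Set.range v) := by rw [hspan]; trivial
      induction hx using Submodule.span_induction with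
      | zero => rw [map_zero]; exact zero_mem _
      | add a b _ _ ha hb => rw [map_add]; exact add_mem ha hb
      | smul c a _ ha => rw [map_smul]; exact Submodule.smul_mem _ c ha
      | mem x hx =>
        obtain ⟨b, rfl⟩ := hx
        change vertexIdem I i • v b ∈ _
        by_cases hb : t b = i
        · rw [show vertexIdem I i • v b = v b by rw [← hb]; exact ht b]
          exact Submodule.subset_span ⟨⟨b, hb⟩, rfl⟩
        · rw [vertexIdem_smul_of_ne (Ne.symm hb) (ht b)]
          exact zero_mem _
    · rw [Submodule.span_le]
      rintro _ ⟨⟨b, rfl⟩, rfl⟩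
      exact ⟨v b, ht b⟩
  rw [dimVec, h, Nat.card_eq_fintype_card]
  exact finrank_span_eq_card (hv.comp _ Subtype.val_injective)

/-- The dimension of a module is the sum of the entries of its dimension vector. -/
theorem finrank_eq_sum_dimVec [Module.Finite K M] :
    Module.finrank K M = ∑ i, dimVec I M i := by
  classical
  let φ : M →ₗ[K] ((i : V) → cornerSpace M K (vertexIdem I i)) :=
    LinearMap.pi fun i => (Algebra.lsmul K K M (vertexIdem I i)).rangeRestrict
  let ψ : ((i : V) → cornerSpace M K (vertexIdem I i)) →ₗ[K] M :=
    ∑ i, (Submodule.subtype _) ∘ₗ LinearMap.proj i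
  have hψ : ∀ y, ψ y = ∑ i, (y i : M) := fun y => by
    simp only [ψ, LinearMap.sum_apply]
    rfl
  have h1 : ψ ∘ₗ φ = LinearMap.id := by
    ext x
    rw [LinearMap.comp_apply, hψ]
    change ∑ i, vertexIdem I i • x = x
    rw [← Finset.sum_smul, sum_vertexIdem, one_smul]
  have h2 : φ ∘ₗ ψ = LinearMap.id := by
    refine LinearMap.ext fun y => funext fun i => Subtype.ext ?_
    rw [LinearMap.comp_apply, hψ]
    change vertexIdem I i • ∑ j, (y j : M) = y i
    have hy : ∀ j, vertexIdem I j • (y j : M) = y j := fun j => by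
      obtain ⟨z, hz⟩ := (y j).2
      rw [← hz, Algebra.lsmul_coe, ← mul_smul, vertexIdem_mul_self]
    rw [Finset.smul_sum, Finset.sum_eq_single i, hy]
    · exact fun j _ hj => vertexIdem_smul_of_ne hj.symm (hy j)
    · simp
  rw [(LinearEquiv.ofLinearMap φ ψ h2 h1).finrank_eq, Module.finrank_pi_fintype]
  rfl

/-- The image of a map that is semilinear along $KQ\to A$ is stable under $K$, since scalars of $K$
lift to $KQ$. So it suffices to hit a spanning set. -/
theorem semilinear_surjective {n : ℕ} {e : Fin n → V}
    (f : PHat K e →ₛₗ[Ideal.Quotient.mk I] M) {s : Set M} (hs : ∀ y ∈ s, ∃ p, f p = y)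
    (hspan : Submodule.span K s = ⊤) : Function.Surjective f := by
  intro y
  have hy : y ∈ Submodule.span K s := by rw [hspan]; trivial
  induction hy using Submodule.span_induction with
  | zero => exact ⟨0, map_zero f⟩
  | add a b _ _ ha hb =>
    obtain ⟨p, rfl⟩ := ha
    obtain ⟨q, rfl⟩ := hb
    exact ⟨p + q, map_add f p q⟩
  | smul c a _ ha =>
    obtain ⟨p, rfl⟩ := ha
    refine ⟨algebraMap K (PathAlgebra K V) c • p, ?_⟩
    rw [map_smulₛₗ]
    exact algebraMap_smul (QuotAlg I) c (f p)
  | mem y hy => exact hs y hy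

variable [DecidableEq V] {n : ℕ} {e : Fin n → V} {σ : Finset (FreePath e)} {x : Fin n → M}

theorem dimVec_eq_of_pathFamily (hli : LinearIndependent K (pathFamily I σ x))
    (htop : Submodule.span K (Set.range (pathFamily I σ x)) = ⊤) (i : V) :
    dimVec I M i = (σ.filter (fun b => b.target = i)).card := by
  rw [dimVec_eq_card hli htop (fun b => b.1.target)
    (fun b => vertexIdem_smul_pathClass_smul _ _) i]
  rw [← Nat.subtype_card (p := fun b => b ∈ σ ∧ b.target = i) _ (by simp)]
  exact Nat.card_congr
    ⟨fun b => ⟨b.1.1, b.1.2, b.2⟩, fun b => ⟨⟨b.1, b.2.1⟩, b.2.2⟩, fun _ => rfl, fun _ => rfl⟩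

/-- If the elements `p x_r` with `p z_r ∈ σ` form a basis of `M`, and if the terms of the radical
filtration of `M` are no larger than `σ` predicts, then `σ` is a skeleton of `M` relative to the
sequence of the `x_r`. -/
theorem isSkeletonRel_of_pathFamily (hI : IsAdmissible I) [Module.Finite K M]
    (hx : ∀ r, vertexIdem I (e r) • x r = x r)
    (hli : LinearIndependent K (pathFamily I σ x))
    (htop : Submodule.span K (Set.range (pathFamily I σ x)) = ⊤)
    (hdim : ∀ l, Module.finrank K (radPow (QuotAlg I) M l) ≤
      Nat.card {b : σ // l ≤ b.1.length}) :
    IsSkeletonRel I σ (fun r : {r : Fin n // FreePath.top e r ∈ σ} => x r.1) := by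
  have hspan := radPow_eq_span (A := QuotAlg I) (len := fun b : σ => b.1.length) hli
    (fun b => pathClass_smul_mem_radPow hI b.1.path (x b.1.root)) hdim
  -- Identifies the distinguished top elements with the degree 0 part of the adapted basis, so that
  -- the latter's residue classes become the full top sequence.
  let E : {r : Fin n // FreePath.top e r ∈ σ} ≃ {b : σ // b.1.length = 0} :=
    { toFun := fun r => ⟨⟨FreePath.top e r.1, r.2⟩, rfl⟩
      invFun := fun b => ⟨b.1.1.root, by
        rw [← FreePath.eq_top_of_length_eq_zero b.2]; exact b.1.2⟩
      left_inv := fun r => rfl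
      right_inv := fun b => Subtype.ext (Subtype.ext
        (FreePath.eq_top_of_length_eq_zero b.2).symm) }
  have hE : ∀ r, pathFamily I σ x (E r).1 = x r.1 := fun r => hx r.1
  have htopli : LinearIndependent K
      (fun r : {r : Fin n // FreePath.top e r ∈ σ} => (radPow (QuotAlg I) M 1).mkQ (x r.1)) := by
    have := (linearIndependent_top hli hspan).comp E E.injective
    simpa only [Function.comp_def, hE] using this
  refine ⟨fun l i => ?_, ⟨fun r => ⟨fun hr => ?_, e r.1, hx r.1⟩, htopli, ?_⟩,
    liftPHat I e x, ?_, fun r => ?_, ?_, ?_⟩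
  · rw [dimVec_eq_card (linearIndependent_radLayer hli hspan l) (span_radLayer hspan l)
      (fun b => b.1.1.target) (fun b => ?_) i]
    · rw [layerCount, ← Nat.subtype_card
        (p := fun b => b ∈ σ ∧ b.length = l ∧ b.target = i) _ (by simp)]
      exact Nat.card_congr
        ⟨fun b => ⟨b.1.1.1, b.1.1.2, b.1.2, b.2⟩, fun b => ⟨⟨⟨b.1, b.2.1⟩, b.2.2.1⟩, b.2.2.2⟩,
          fun _ => rfl, fun _ => rfl⟩
    · rw [← map_smul]
      congr 1
      exact Subtype.ext (vertexIdem_smul_pathClass_smul _ _)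
  · exact htopli.ne_zero r ((Submodule.Quotient.mk_eq_zero _).2 hr)
  · have := span_top hspan
    rw [← this]
    congr 1
    ext y
    constructor
    · rintro ⟨r, rfl⟩
      exact ⟨E r, by simp only [hE]⟩
    · rintro ⟨b, rfl⟩
      obtain ⟨r, rfl⟩ := E.surjective b
      exact ⟨r, by simp only [hE]⟩
  · refine semilinear_surjective _ (s := Set.range (pathFamily I σ x)) ?_ htop
    rintro _ ⟨b, rfl⟩
    exact ⟨b.1.toPHat, by rw [semilinear_toPHat, liftPHat_z, hx]; rfl⟩
  · rw [liftPHat_z, hx]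
  · convert hli using 2 with b
    rw [semilinear_toPHat, liftPHat_z, hx]; rfl
  · rw [← htop]
    congr 2
    ext b
    rw [semilinear_toPHat, liftPHat_z, hx]; rfl

end Criterion

/-! ### The socle of a self-injective algebra with $J^3=0$ -/

section SelfInjective

variable {K : Type u} [Field K] {V : Type v} [Quiver.{w} V] [Fintype V]
  {I : Ideal (PathAlgebra K V)} [I.IsTwoSided]

/-- In a self-injective algebra `KQ / I`, an element of `e_j A e_i` which is annihilated by the
radical on both sides determines `i` by `j`: any two such elements in the left socle differ by a
right multiplication. -/
theorem vertex_eq_of_socle (hI : IsAdmissible I)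
    (hself : Module.Injective (QuotAlg I) (QuotAlg I)) {i i' j : V} {x y : QuotAlg I}
    (hx : x ≠ 0) (hy : y ≠ 0) (hjx : vertexIdem I j * x = x) (hjy : vertexIdem I j * y = y)
    (hxi : x * vertexIdem I i = x) (hyi : y * vertexIdem I i' = y)
    (hJx : ∀ a ∈ Ring.jacobson (QuotAlg I), a * x = 0)
    (hJy : ∀ a ∈ Ring.jacobson (QuotAlg I), a * y = 0)
    (hxJ : ∀ a ∈ Ring.jacobson (QuotAlg I), x * a = 0) : i = i' := by
  classical
  -- An element of $e_jA$ killed by $J$ from the left spans a copy of $S_j$: every $a$ acts by its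
  -- coefficient at $e_j$. Hence $x$ and $y$ have the same left annihilator.
  have left : ∀ z : QuotAlg I, vertexIdem I j * z = z →
      (∀ a ∈ Ring.jacobson (QuotAlg I), a * z = 0) → ∀ a, a * z = vertexCoeff hI j a • z := by
    intro z hz hJ a
    have h := hJ _ (sub_sum_vertexCoeff_mem_jacobson hI a)
    rw [sub_mul, sub_eq_zero] at h
    rw [h, Finset.sum_mul, Finset.sum_eq_single j, smul_mul_assoc, hz]
    · intro k _ hk
      rw [← hz, smul_mul_assoc, ← mul_assoc, vertexIdem_mul_of_ne hk, zero_mul, smul_zero]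
    · simp
  let f₁ := LinearMap.toSpanSingleton (QuotAlg I) (QuotAlg I) x
  let f₂ := LinearMap.toSpanSingleton (QuotAlg I) (QuotAlg I) y
  have hker : LinearMap.ker f₁ ≤ LinearMap.ker f₂ := by
    intro a ha
    have ha' : a * x = 0 := ha
    change a * y = 0
    rw [left x hjx hJx, smul_eq_zero] at ha'
    rw [left y hjy hJy, ha'.resolve_right hx, zero_smul]
  -- Injectivity extends the map $Ax\to A$, $x\mapsto y$, to an endomorphism of ${}_AA$, which is
  -- right multiplication by $g(1)$.
  obtain ⟨g, hg⟩ := hself.out (X := QuotAlg I ⧸ LinearMap.ker f₁)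
    ((LinearMap.ker f₁).liftQ f₁ le_rfl)
    (LinearMap.ker_eq_bot.1 (Submodule.ker_liftQ_eq_bot _ _ _ le_rfl))
    ((LinearMap.ker f₁).liftQ f₂ hker)
  have h1 := hg (Submodule.Quotient.mk 1)
  rw [Submodule.liftQ_apply, Submodule.liftQ_apply] at h1
  have hgx : x * g 1 = y := by
    rw [← smul_eq_mul, ← map_smul, smul_eq_mul, mul_one]
    simpa [f₁, f₂] using h1
  -- As $x$ also kills $J$ from the right, this multiplication only rescales $x$. So $y$ is a
  -- multiple of $x$ and must start at the same vertex.
  have hright : x * g 1 = vertexCoeff hI i (g 1) • x := by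
    have h := hxJ _ (sub_sum_vertexCoeff_mem_jacobson hI (g 1))
    rw [mul_sub, sub_eq_zero] at h
    rw [h, Finset.mul_sum, Finset.sum_eq_single i, mul_smul_comm, hxi]
    · intro k _ hk
      rw [← hxi, mul_smul_comm, mul_assoc, vertexIdem_mul_of_ne hk.symm, mul_zero, smul_zero]
    · simp
  by_contra hne
  apply hy
  rw [← hyi, ← hgx, hright, ← hxi, smul_mul_assoc, mul_assoc, vertexIdem_mul_of_ne hne, mul_zero,
    smul_zero]

theorem mul_mul_eq_zero_of_jacobson_pow (hJ : Ring.jacobson (QuotAlg I) ^ 3 = ⊥)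
    {a b c : QuotAlg I} (ha : a ∈ Ring.jacobson (QuotAlg I)) (hb : b ∈ Ring.jacobson (QuotAlg I))
    (hc : c ∈ Ring.jacobson (QuotAlg I)) : a * b * c = 0 := by
  have h : a * b * c ∈ Ring.jacobson (QuotAlg I) ^ 3 := by
    rw [Submodule.pow_succ, Submodule.pow_succ, Submodule.pow_one]
    exact Submodule.mul_mem_mul (Submodule.mul_mem_mul ha hb) hc
  rwa [hJ, Submodule.mem_bot] at h

theorem exists_jacobson_mul_jacobson (hI : IsAdmissible I) {a b : V} (p : Quiver.Path a b)
    (hp : p.length = 2) : ∃ x ∈ Ring.jacobson (QuotAlg I), ∃ y ∈ Ring.jacobson (QuotAlg I),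
      pathClass I p = x * y := by
  cases p with
  | nil => simp at hp
  | cons p α =>
    refine ⟨pathClass I α.toPath, pathClass_mem_jacobson hI _ (by simp), pathClass I p,
      pathClass_mem_jacobson hI _ ?_, pathClass_comp p α.toPath⟩
    rw [Quiver.Path.length_cons] at hp
    omega

end SelfInjective

/-! ### Trees that are skeleta of indecomposable projectives -/

section ProjectiveTrees

section Finiteness

variable {K : Type*} [Field K] {A : Type*} [Ring A] [Algebra K A]
  {M : Type*} [AddCommGroup M] [Module A M] [Module K M] [IsScalarTower K A M]
  [Module.Finite K M] (l : ℕ)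

theorem finite_radPow : Module.Finite K (radPow A M l) :=
  inferInstanceAs (Module.Finite K ((radPow A M l).restrictScalars K))

theorem finite_radLayer : Module.Finite K (RadLayer A M l) :=
  let N := (radPow A M (l + 1)).submoduleOf (radPow A M l)
  let q := N.mkQ.restrictScalars K
  have hq : Function.Surjective q := Submodule.mkQ_surjective N
  have := finite_radPow (K := K) (A := A) (M := M) l
  Module.Finite.of_surjective q hq

theorem finrank_radPow :
    Module.finrank K (radPow A M l) =
      Module.finrank K (RadLayer A M l) + Module.finrank K (radPow A M (l + 1)) := by
  have := finite_radPow (K := K) (A := A) (M := M) l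
  let N := (radPow A M (l + 1)).submoduleOf (radPow A M l)
  let q := N.mkQ.restrictScalars K
  have hq : Function.Surjective q := Submodule.mkQ_surjective N
  rw [← LinearMap.finrank_range_add_finrank_ker q, LinearMap.range_eq_top.2 hq, finrank_top]
  congr 1
  have hk : LinearMap.ker q = N.restrictScalars K := by
    rw [LinearMap.ker_restrictScalars, Submodule.ker_mkQ]
  rw [hk]
  exact ((Submodule.submoduleOfEquivOfLe (radPow_succ_le (A := A) (M := M) l)).restrictScalars
    K).finrank_eq

end Finiteness

variable {K : Type u} [Field K] {V : Type v} [Quiver.{w} V] [Fintype V]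
  {I : Ideal (PathAlgebra K V)} [I.IsTwoSided]

theorem coe_mul_vertexIdem {i : V} (y : IndecProj I i) :
    (y : QuotAlg I) * vertexIdem I i = y := by
  obtain ⟨a, ha⟩ := Ideal.mem_span_singleton'.1 y.2
  rw [← ha, mul_assoc, vertexIdem_mul_self]

theorem mem_radPow_one_of_mem_jacobson {i : V} {y : IndecProj I i}
    (hy : (y : QuotAlg I) ∈ Ring.jacobson (QuotAlg I)) :
    y ∈ radPow (QuotAlg I) (IndecProj I i) 1 := by
  have h : y = (y : QuotAlg I) • (⟨vertexIdem I i, Ideal.subset_span rfl⟩ : IndecProj I i) :=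
    Subtype.ext (coe_mul_vertexIdem y).symm
  rw [h]
  exact Submodule.smul_mem_smul hy trivial

theorem idem_smul_z {n : ℕ} (e : Fin n → V) (r : Fin n) :
    PathAlgebra.idem K (e r) • ProjSum.z (PathAlgebra.idem K) e r =
      ProjSum.z (PathAlgebra.idem K) e r := by
  rw [ProjSum.z, ← Pi.single_smul]
  congr 1
  exact Subtype.ext (PathAlgebra.ofPath_mul_idem _)

theorem radPow_eq_bot_of_loewyLength {A M : Type*} [Ring A] [AddCommGroup M] [Module A M] {k : ℕ}
    (h : loewyLength A M = k + 1) : radPow A M (k + 1) = ⊥ := by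
  -- The infimum of the empty set of naturals is 0, so a positive Loewy length shows that the
  -- infimum is attained.
  have hne : {N : ℕ | radPow A M N = ⊥}.Nonempty := by
    by_contra h'
    rw [Set.not_nonempty_iff_eq_empty] at h'
    rw [loewyLength, h', Nat.sInf_empty] at h
    omega
  have := Nat.sInf_mem hne
  rwa [show sInf {N : ℕ | radPow A M N = ⊥} = k + 1 from h] at this

theorem radPow_ne_bot_of_lt_loewyLength {A M : Type*} [Ring A] [AddCommGroup M] [Module A M]
    {k : ℕ} (h : k < loewyLength A M) : radPow A M k ≠ ⊥ :=
  fun h' => Nat.notMem_of_lt_sInf h h'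

variable [DecidableEq V] {n : ℕ} {e : Fin n → V}

theorem sum_layerCount (σ : Finset (FreePath e)) (l : ℕ) :
    ∑ i, layerCount σ l i = (σ.filter (fun b => b.length = l)).card := by
  rw [Finset.card_eq_sum_card_fiberwise (f := fun b => b.target) (t := Finset.univ)
    (fun _ _ => Finset.mem_coe.2 (Finset.mem_univ _))]
  refine Finset.sum_congr rfl fun i _ => ?_
  rw [layerCount, Finset.filter_filter]

theorem finrank_radPow_le_of_hasLayering {M : Type*} [AddCommGroup M] [Module (QuotAlg I) M]
    [Module K M] [IsScalarTower K (QuotAlg I) M] [Module.Finite K M] {σ : Finset (FreePath e)}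
    (hσ : HasLayering I M σ) {N : ℕ} (hN : radPow (QuotAlg I) M N = ⊥) (l : ℕ) :
    Module.finrank K (radPow (QuotAlg I) M l) ≤ Nat.card {b : σ // l ≤ b.1.length} := by
  classical
  -- Descending induction on $l$ from $J^NM=0$, with $k$ bounding the distance to $N$; each step
  -- adds one radical layer.
  have key : ∀ k l, N ≤ l + k → Module.finrank K (radPow (QuotAlg I) M l) ≤
      (σ.filter (fun b => l ≤ b.length)).card := by
    intro k
    induction k with
    | zero =>
      intro l hl
      have h0 : radPow (QuotAlg I) M l = ⊥ :=
        eq_bot_iff.2 ((radPow_antitone (A := QuotAlg I) (M := M) hl).trans hN.le)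
      rw [h0]
      exact (finrank_bot K M).le.trans (Nat.zero_le _)
    | succ k ih =>
      intro l hl
      have := finite_radLayer (K := K) (A := QuotAlg I) (M := M) l
      rw [finrank_radPow, finrank_eq_sum_dimVec (I := I), Finset.sum_congr rfl fun i _ => hσ l i,
        sum_layerCount]
      refine (Nat.add_le_add_left (ih (l + 1) (by omega)) _).trans ?_
      rw [← Finset.card_union_of_disjoint]
      · refine Finset.card_le_card fun b hb => ?_
        simp only [Finset.mem_union, Finset.mem_filter] at hb ⊢
        rcases hb with hb | hb
        · exact ⟨hb.1, hb.2.ge⟩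
        · exact ⟨hb.1, by omega⟩
      · refine Finset.disjoint_left.2 fun b hb hb' => ?_
        simp only [Finset.mem_filter] at hb hb'
        omega
  refine (key N l (by omega)).trans_eq ?_
  rw [← Nat.subtype_card (p := fun b => b ∈ σ ∧ l ≤ b.length) _ (by simp)]
  exact Nat.card_congr
    ⟨fun b => ⟨⟨b.1, b.2.1⟩, b.2.2⟩, fun b => ⟨b.1.1, b.1.2, b.2⟩, fun _ => rfl, fun _ => rfl⟩

omit [Fintype V] [DecidableEq V] in
theorem root_of_mem_tree {σ : Finset (FreePath e)} {r : Fin n} {b : FreePath e}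
    (hb : b ∈ tree σ r) : b.root = r := (Finset.mem_filter.1 hb).2

/-- If the tree of `σ` with root `z_r` is a skeleton of `A e_i`, then `A e_i` has an element `x`
such that the `p x` with `p z_r` in the tree are a basis which is adapted to the radical
filtration. -/
theorem exists_generator_of_tree {σ : Finset (FreePath e)} {r : Fin n} {i : V} {N : ℕ}
    (hN : radPow (QuotAlg I) (IndecProj I i) N = ⊥) (hI : IsAdmissible I)
    (h : IsSkeletonOf I (IndecProj I i) (tree σ r)) :
    ∃ x : IndecProj I i, vertexIdem I (e r) • x = x ∧
      LinearIndependent K (pathFamily I (tree σ r) (fun _ => x)) ∧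
      ∀ l, (radPow (QuotAlg I) (IndecProj I i) l).restrictScalars K =
        Submodule.span K (pathFamily I (tree σ r) (fun _ => x) '' {b | l ≤ b.1.length}) := by
  obtain ⟨x', hlayer, -, f, -, -, hli, hspan⟩ := h
  have hfam : (fun b : tree σ r => f b.1.toPHat) = pathFamily I (tree σ r)
      (fun _ => f (ProjSum.z (PathAlgebra.idem K) e r)) := by
    ext1 b
    rw [semilinear_toPHat]
    exact congrArg (fun s => pathClass I b.1.path • f (ProjSum.z (PathAlgebra.idem K) e s))
      (root_of_mem_tree b.2)
  have hfin : Module.Finite K (IndecProj I i) :=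
    ⟨Submodule.fg_def.2 ⟨_, Set.finite_range _, hspan⟩⟩
  rw [hfam] at hli
  refine ⟨f (ProjSum.z (PathAlgebra.idem K) e r), ?_, hli, ?_⟩
  · exact (map_smulₛₗ f _ _).symm.trans (congrArg f (idem_smul_z e r))
  · exact radPow_eq_span hli (fun b => pathClass_smul_mem_radPow hI b.1.path _)
      (finrank_radPow_le_of_hasLayering hlayer hN)

/-- A set `σ` of paths, closed under initial subpaths, in normal form: the trees with root in `X`
are skeleta of indecomposable projective modules of Loewy length `3`, and the remaining trees
consist of paths of length at most `1`. -/
structure NormalForm (I : Ideal (PathAlgebra K V)) [I.IsTwoSided] (σ : Finset (FreePath e))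
    (X : Finset (Fin n)) : Prop where
  initial : ∀ (r : Fin n) (j k : V) (p₁ : Quiver.Path (e r) j) (p₂ : Quiver.Path j k),
    (⟨r, k, p₁.comp p₂⟩ : FreePath e) ∈ σ → (⟨r, j, p₁⟩ : FreePath e) ∈ σ
  short : ∀ b ∈ σ, b.root ∉ X → b.length ≤ 1
  loewy : ∀ r ∈ X, loewyLength (QuotAlg I) (IndecProj I (e r)) = 3
  proj : ∀ r ∈ X, IsSkeletonOf I (IndecProj I (e r)) (tree σ r)

/-- If $i\ne e(r)$, the image of $z_r$ lies in $e_{e(r)}Ae_i\subseteq J$. It would then be a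
combination of the images of the paths of positive length, contradicting linear independence. -/
theorem vertex_eq_of_tree (hI : IsAdmissible I) {σ : Finset (FreePath e)}
    (hinit : ∀ (r : Fin n) (j k : V) (p₁ : Quiver.Path (e r) j) (p₂ : Quiver.Path j k),
      (⟨r, k, p₁.comp p₂⟩ : FreePath e) ∈ σ → (⟨r, j, p₁⟩ : FreePath e) ∈ σ)
    {r : Fin n} {i : V} {N : ℕ} (hN : loewyLength (QuotAlg I) (IndecProj I i) = N + 1)
    (h : IsSkeletonOf I (IndecProj I i) (tree σ r)) : i = e r := by
  obtain ⟨x, hx, hli, hspan⟩ := exists_generator_of_tree (radPow_eq_bot_of_loewyLength hN) hI h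
  -- An empty tree would have an empty basis, making $Ae_i$ zero and its Loewy length 0.
  have hne : (tree σ r).Nonempty := by
    by_contra hemp
    rw [Finset.not_nonempty_iff_eq_empty] at hemp
    have h0 := hspan 0
    have : IsEmpty (tree σ r) := by rw [hemp]; infer_instance
    rw [Set.eq_empty_of_isEmpty {b : tree σ r | 0 ≤ b.1.length}, Set.image_empty,
      Submodule.span_empty] at h0
    refine radPow_ne_bot_of_lt_loewyLength (A := QuotAlg I) (M := IndecProj I i) (k := 0)
      (by omega) ?_
    exact (Submodule.restrictScalars_eq_bot_iff K _ _).1 h0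
  obtain ⟨⟨s, k, p⟩, hb⟩ := hne
  obtain rfl : s = r := root_of_mem_tree hb
  have htop : FreePath.top e s ∈ tree σ s := Finset.mem_filter.2
    ⟨hinit s (e s) k Quiver.Path.nil p (by
      rw [Quiver.Path.nil_comp]; exact (Finset.mem_filter.1 hb).1), rfl⟩
  by_contra hne
  have hxJ : (x : QuotAlg I) ∈ Ring.jacobson (QuotAlg I) := by
    refine (mem_jacobson_iff_vertexCoeff hI).2 fun k => ?_
    have hx' : vertexIdem I (e s) * (x : QuotAlg I) = x := congrArg Subtype.val hx
    rw [← hx', vertexCoeff_mul, ← coe_mul_vertexIdem x, vertexCoeff_mul]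
    by_cases hk : i = k
    · subst hk
      rw [vertexCoeff_vertexIdem_of_ne hI (Ne.symm hne), zero_mul]
    · rw [vertexCoeff_vertexIdem_of_ne hI hk, mul_zero, mul_zero]
  have h1 : x ∈ (radPow (QuotAlg I) (IndecProj I i) 1).restrictScalars K :=
    mem_radPow_one_of_mem_jacobson hxJ
  rw [hspan] at h1
  have h2 : pathFamily I (tree σ s) (fun _ => x) ⟨FreePath.top e s, htop⟩ = x := hx
  refine hli.notMem_span_image (s := {b | 1 ≤ b.1.length})
    (x := ⟨FreePath.top e s, htop⟩) ?_ (by rw [h2]; exact h1)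
  exact fun h => absurd (show 1 ≤ 0 from h) (by omega)

theorem exists_normalForm (hI : IsAdmissible I) {σ : Finset (FreePath e)} (hσ : IsSkeleton I σ)
    (hn : IsNormalized I σ) : ∃ X, NormalForm I σ X := by
  classical
  obtain ⟨X, hX, hX'⟩ := hn
  refine ⟨Finset.univ.filter (· ∈ X), hσ.initial, fun b hb hr => hX b hb (by simpa using hr),
    fun r hr => ?_, fun r hr => ?_⟩
  all_goals
    obtain ⟨i, hi, hs⟩ := hX' r (by simpa using hr)
    obtain rfl := vertex_eq_of_tree hI hσ.initial hi hs
    assumption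

end ProjectiveTrees

/-! ### Matching the trees and the remaining paths of two skeleta -/

section Counting

variable {K : Type u} [Field K] {V : Type v} [Quiver.{w} V] [Fintype V]
  {I : Ideal (PathAlgebra K V)} [I.IsTwoSided] [DecidableEq V] {n : ℕ} {e : Fin n → V}
  {σ τ : Finset (FreePath e)} {X Y : Finset (Fin n)}

/-- The paths of length `l` in `σ` whose root lies outside `X`. -/
abbrev RestPath (σ : Finset (FreePath e)) (X : Finset (Fin n)) (l : ℕ) : Type _ :=
  {b : FreePath e // b ∈ σ ∧ b.root ∉ X ∧ b.length = l}

instance (σ : Finset (FreePath e)) (X : Finset (Fin n)) (l : ℕ) : Finite (RestPath σ X l) :=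
  Finite.of_injective (fun b : RestPath σ X l => (⟨b.1, b.2.1⟩ : σ)) fun _ _ h =>
    Subtype.ext (congrArg (fun z : σ => z.1) h)

omit [Fintype V] in
theorem layerCount_eq_sum_add (σ : Finset (FreePath e)) (X : Finset (Fin n)) (l : ℕ) (j : V) :
    layerCount σ l j = ∑ r ∈ X, layerCount (tree σ r) l j +
      Nat.card {b : RestPath σ X l // b.1.target = j} := by
  classical
  rw [layerCount, ← Finset.card_filter_add_card_filter_not (fun b => b.root ∈ X)]
  congr 1
  · rw [Finset.card_eq_sum_card_fiberwise (f := FreePath.root) (t := X)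
      (by intro b hb; exact (Finset.mem_filter.1 (Finset.mem_coe.1 hb)).2)]
    refine Finset.sum_congr rfl fun r hr => ?_
    rw [layerCount, tree]
    congr 1
    ext b
    simp only [Finset.mem_filter]
    constructor
    · rintro ⟨⟨⟨h1, h2⟩, -⟩, h3⟩
      exact ⟨⟨h1, h3⟩, h2⟩
    · rintro ⟨⟨h1, h3⟩, h2⟩
      exact ⟨⟨⟨h1, h2⟩, h3 ▸ hr⟩, h3⟩
  · rw [← Nat.subtype_card
      (p := fun b => b ∈ σ ∧ b.length = l ∧ b.target = j ∧ b.root ∉ X) _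
      (by simp only [Finset.mem_filter]; tauto)]
    exact Nat.card_congr
      ⟨fun b => ⟨⟨b.1, b.2.1, b.2.2.2.2, b.2.2.1⟩, b.2.2.2.1⟩,
        fun b => ⟨b.1.1, b.1.2.1, b.1.2.2.2, b.2, b.1.2.2.1⟩, fun _ => rfl, fun _ => rfl⟩

/-- What matters is that the right-hand side depends only on the vertex $e(r)$, not on the tree or
on the skeleton containing it. -/
theorem NormalForm.layerCount_tree (hσ : NormalForm I σ X) {r : Fin n} (hr : r ∈ X) (l : ℕ)
    (j : V) : layerCount (tree σ r) l j =
      dimVec I (RadLayer (QuotAlg I) (IndecProj I (e r)) l) j := by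
  obtain ⟨x, hx⟩ := hσ.proj r hr
  exact (hx.layering l j).symm

/-- Loewy length 3 means $J^2Ae_{e(r)}\ne0$. This space is spanned by the images of paths of length
at least 2, and those of length at least 3 vanish. -/
theorem NormalForm.exists_length_two (hI : IsAdmissible I) (hσ : NormalForm I σ X) {r : Fin n}
    (hr : r ∈ X) : ∃ b ∈ tree σ r, b.length = 2 := by
  have hbot := radPow_eq_bot_of_loewyLength (hσ.loewy r hr)
  obtain ⟨x, hx, hli, hspan⟩ := exists_generator_of_tree hbot hI (hσ.proj r hr)
  by_contra hcon
  push Not at hcon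
  refine radPow_ne_bot_of_lt_loewyLength (A := QuotAlg I) (M := IndecProj I (e r)) (k := 2)
    (by rw [hσ.loewy r hr]; omega) ?_
  rw [← Submodule.restrictScalars_eq_bot_iff K (QuotAlg I), hspan, Submodule.span_eq_bot]
  rintro _ ⟨b, hb, rfl⟩
  have h2 : 2 ≤ b.1.length := hb
  have h3 : 3 ≤ b.1.length := by
    have := hcon b.1 b.2
    omega
  have := radPow_antitone h3 (pathClass_smul_mem_radPow hI b.1.path x)
  rwa [hbot, Submodule.mem_bot] at this

/-- A path of length 2 in such a tree yields a nonzero product of two radical elements and the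
generator. By $J^3=0$ it is killed by $J$ on both sides, so `vertex_eq_of_socle` applies. -/
theorem NormalForm.vertex_eq (hI : IsAdmissible I)
    (hself : Module.Injective (QuotAlg I) (QuotAlg I))
    (hJ : Ring.jacobson (QuotAlg I) ^ 3 = ⊥) (hσ : NormalForm I σ X) (hτ : NormalForm I τ Y)
    {r s : Fin n} (hr : r ∈ X) (hs : s ∈ Y) {b c : FreePath e} (hb : b ∈ tree σ r)
    (hc : c ∈ tree τ s) (hb2 : b.length = 2) (hc2 : c.length = 2) (hbc : b.target = c.target) :
    e r = e s := by
  have key : ∀ {ρ : Finset (FreePath e)} {Z : Finset (Fin n)} (_ : NormalForm I ρ Z) {t : Fin n}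
      (_ : t ∈ Z) {d : FreePath e} (_ : d ∈ tree ρ t) (_ : d.length = 2),
      ∃ y : QuotAlg I, y ≠ 0 ∧ vertexIdem I d.target * y = y ∧ y * vertexIdem I (e t) = y ∧
        (∀ a ∈ Ring.jacobson (QuotAlg I), a * y = 0) ∧
        (∀ a ∈ Ring.jacobson (QuotAlg I), y * a = 0) := by
    intro ρ Z hρ t ht d hd hd2
    obtain ⟨x, -, hli, -⟩ := exists_generator_of_tree
      (radPow_eq_bot_of_loewyLength (hρ.loewy t ht)) hI (hρ.proj t ht)
    obtain ⟨a₁, h₁, a₂, h₂, h₁₂⟩ := exists_jacobson_mul_jacobson hI d.path hd2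
    have hne := hli.ne_zero ⟨d, hd⟩
    rw [pathFamily_apply] at hne
    refine ⟨pathClass I d.path * x, fun h0 => hne ?_, ?_, ?_, ?_, ?_⟩
    · rw [← Submodule.coe_eq_zero, Submodule.coe_smul, smul_eq_mul]
      exact h0
    · rw [← mul_assoc, vertexIdem_mul_pathClass]
    · rw [mul_assoc, coe_mul_vertexIdem]
    · intro a ha
      rw [h₁₂, ← mul_assoc, ← mul_assoc, mul_mul_eq_zero_of_jacobson_pow hJ ha h₁ h₂, zero_mul]
    · intro a ha
      rw [h₁₂, mul_assoc, mul_mul_eq_zero_of_jacobson_pow hJ h₁ h₂]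
      exact Ideal.mul_mem_left _ _ ha
  obtain ⟨y, hy, hy1, hy2, hy3, hy4⟩ := key hσ hr hb hb2
  obtain ⟨z, hz, hz1, hz2, hz3, -⟩ := key hτ hs hc hc2
  rw [← hbc] at hz1
  exact vertex_eq_of_socle hI hself hy hz hy1 hz1 hy2 hz2 hy3 hz3 hy4

/-- By `NormalForm.vertex_eq`, only trees rooted at the vertex $e(r)$ contribute paths of length 2
with this end point, and each contributes the same number. -/
theorem NormalForm.layerCount_two (hI : IsAdmissible I)
    (hself : Module.Injective (QuotAlg I) (QuotAlg I))
    (hJ : Ring.jacobson (QuotAlg I) ^ 3 = ⊥) (hσ : NormalForm I σ X) (hτ : NormalForm I τ Y)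
    {r : Fin n} (hr : r ∈ X) {b : FreePath e} (hb : b ∈ tree σ r) (hb2 : b.length = 2) :
    layerCount τ 2 b.target = (Y.filter (fun s => e s = e r)).card *
      layerCount (tree σ r) 2 b.target := by
  have h0 : Nat.card {c : RestPath τ Y 2 // c.1.target = b.target} = 0 := by
    have : IsEmpty {c : RestPath τ Y 2 // c.1.target = b.target} := ⟨fun c => by
      have h1 := hτ.short _ c.1.2.1 c.1.2.2.1
      have h2 := c.1.2.2.2
      omega⟩
    exact Nat.card_of_isEmpty
  rw [layerCount_eq_sum_add τ Y, h0, add_zero, Finset.card_filter, Finset.sum_mul]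
  refine Finset.sum_congr rfl fun s hs => ?_
  split_ifs with h
  · rw [one_mul, hτ.layerCount_tree hs, hσ.layerCount_tree hr, h]
  · rw [zero_mul, layerCount, Finset.card_eq_zero, Finset.filter_eq_empty_iff]
    rintro c hc ⟨hc2, hcb⟩
    exact h (hσ.vertex_eq hI hself hJ hτ hr hs hb hc hb2 hc2 hcb.symm).symm

theorem NormalForm.card_filter_root_eq (hI : IsAdmissible I)
    (hself : Module.Injective (QuotAlg I) (QuotAlg I))
    (hJ : Ring.jacobson (QuotAlg I) ^ 3 = ⊥) (hσ : NormalForm I σ X) (hτ : NormalForm I τ Y)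
    (hS : ∀ l i, layerCount σ l i = layerCount τ l i) (i : V) :
    (X.filter (fun s => e s = i)).card = (Y.filter (fun s => e s = i)).card := by
  have key : ∀ {ρ π : Finset (FreePath e)} {Z W : Finset (Fin n)} (_ : NormalForm I ρ Z)
      (_ : NormalForm I π W) (_ : ∀ l i, layerCount ρ l i = layerCount π l i),
      (∃ r ∈ Z, e r = i) →
      (Z.filter (fun s => e s = i)).card = (W.filter (fun s => e s = i)).card := by
    rintro ρ π Z W hρ hπ hS ⟨r, hr, rfl⟩
    obtain ⟨b, hb, hb2⟩ := hρ.exists_length_two hI hr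
    -- Counting the paths of length 2 ending where $b$ ends, once in each skeleton, gives the two
    -- numbers of trees times a common positive factor, which cancels.
    have h1 := hρ.layerCount_two hI hself hJ hρ hr hb hb2
    have h2 := hρ.layerCount_two hI hself hJ hπ hr hb hb2
    rw [hS, h2] at h1
    have hpos : 0 < layerCount (tree ρ r) 2 b.target :=
      Finset.card_pos.2 ⟨b, Finset.mem_filter.2 ⟨hb, hb2, rfl⟩⟩
    exact (Nat.eq_of_mul_eq_mul_right hpos h1).symm
  by_cases h1 : ∃ r ∈ X, e r = i
  · exact key hσ hτ hS h1
  by_cases h2 : ∃ r ∈ Y, e r = i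
  · exact (key hτ hσ (fun l i => (hS l i).symm) h2).symm
  push Not at h1 h2
  rw [Finset.filter_eq_empty_iff.2 fun r hr => h1 r hr,
    Finset.filter_eq_empty_iff.2 fun r hr => h2 r hr]

theorem exists_equiv_of_card_fiber_eq {α β γ : Type*} [Finite α] [Finite β] {f : α → γ}
    {g : β → γ} (h : ∀ c, Nat.card {a // f a = c} = Nat.card {b // g b = c}) :
    ∃ E : α ≃ β, ∀ a, g (E a) = f a := by
  have E := fun c => (Finite.card_eq.1 (h c)).some
  refine ⟨(Equiv.sigmaFiberEquiv f).symm.trans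
    ((Equiv.sigmaCongrRight E).trans (Equiv.sigmaFiberEquiv g)), fun a => ?_⟩
  exact (E (f a) ⟨a, rfl⟩).2

theorem NormalForm.exists_root_equiv (hI : IsAdmissible I)
    (hself : Module.Injective (QuotAlg I) (QuotAlg I))
    (hJ : Ring.jacobson (QuotAlg I) ^ 3 = ⊥) (hσ : NormalForm I σ X) (hτ : NormalForm I τ Y)
    (hS : ∀ l i, layerCount σ l i = layerCount τ l i) :
    ∃ E : Y ≃ X, ∀ r, e (E r) = e r := by
  refine exists_equiv_of_card_fiber_eq (f := fun r : Y => e r) (g := fun r : X => e r)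
    fun i => ?_
  have key : ∀ Z : Finset (Fin n), Nat.card {r : Z // e r = i} =
      (Z.filter (fun s => e s = i)).card := fun Z => by
    rw [← Nat.subtype_card (p := fun r => r ∈ Z ∧ e r = i) _ (by simp)]
    exact Nat.card_congr
      ⟨fun b => ⟨b.1.1, b.1.2, b.2⟩, fun b => ⟨⟨b.1, b.2.1⟩, b.2.2⟩, fun _ => rfl, fun _ => rfl⟩
  rw [key, key, hσ.card_filter_root_eq hI hself hJ hτ hS]

/-- The bijection of roots preserves vertices, so the projective trees contribute equally to each
layer and can be subtracted. -/
theorem NormalForm.exists_restPath_equiv (hσ : NormalForm I σ X) (hτ : NormalForm I τ Y)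
    (hS : ∀ l i, layerCount σ l i = layerCount τ l i) (E : Y ≃ X) (hE : ∀ r, e (E r) = e r)
    (l : ℕ) : ∃ F : RestPath τ Y l ≃ RestPath σ X l, ∀ b, (F b).1.target = b.1.target := by
  refine exists_equiv_of_card_fiber_eq (f := fun b : RestPath τ Y l => b.1.target)
    (g := fun b : RestPath σ X l => b.1.target) fun j => ?_
  have h := hS l j
  rw [layerCount_eq_sum_add σ X, layerCount_eq_sum_add τ Y,
    Finset.sum_congr rfl fun r hr => hσ.layerCount_tree hr l j,
    Finset.sum_congr rfl fun r hr => hτ.layerCount_tree hr l j] at h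
  have key : ∀ g : V → ℕ, ∑ r ∈ X, g (e r) = ∑ r ∈ Y, g (e r) := fun g => by
    rw [← Finset.sum_coe_sort X, ← Finset.sum_coe_sort Y, ← E.sum_comp]
    exact Finset.sum_congr rfl fun r _ => by rw [hE]
  rw [key fun i => dimVec I (RadLayer (QuotAlg I) (IndecProj I i) l) j] at h
  omega

end Counting

/-! ### Linear independence along a polynomial curve -/

section Interpolation

open Polynomial in
/-- A square family of vectors depending quadratically on a parameter `s` is linearly independent
for almost all `s`, provided that it is for one `s`. -/
theorem finite_setOf_not_linearIndependent {K W ι : Type*} [Field K] [AddCommGroup W] [Module K W]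
    [Module.Finite K W] [Fintype ι] (hcard : Fintype.card ι = Module.finrank K W)
    {f : K → ι → W} (a b c : ι → W) (hf : ∀ s i, f s i = a i + s • b i + s ^ 2 • c i) {s₀ : K}
    (h : LinearIndependent K (f s₀)) : {s | ¬ LinearIndependent K (f s)}.Finite := by
  classical
  let B : Module.Basis ι K W := (Module.finBasis K W).reindex
    (Fintype.equivOfCardEq (by rw [Fintype.card_fin, hcard]))
  -- The coordinate matrix with $s$ replaced by an indeterminate; its determinant is nonzero because
  -- of $s_0$, and its roots contain the exceptional set.
  let P : Matrix ι ι K[X] := Matrix.of fun k i =>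
    C (B.repr (a i) k) + X * C (B.repr (b i) k) + X ^ 2 * C (B.repr (c i) k)
  have hP : ∀ s, P.det.eval s = B.det (f s) := by
    intro s
    rw [Module.Basis.det_apply, ← Polynomial.coe_evalRingHom, RingHom.map_det]
    congr 1
    ext k i
    simp [P, Module.Basis.toMatrix_apply, hf]
    ring
  have hli : ∀ s, LinearIndependent K (f s) → P.det.eval s ≠ 0 := by
    intro s hs
    rw [hP]
    exact ((Module.Basis.is_basis_iff_det B).1
      ⟨hs, hs.span_eq_top_of_card_eq_finrank' hcard⟩).ne_zero
  have hP0 : P.det ≠ 0 := fun h0 => hli s₀ h (by rw [h0, eval_zero])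
  refine (Polynomial.finite_setOfPred_isRoot hP0).subset fun s hs => ?_
  by_contra hroot
  refine hs ((Module.Basis.is_basis_iff_det B).2 ?_).1
  rw [← hP]
  exact isUnit_iff_ne_zero.2 hroot

end Interpolation

/-! ### Modules with two semisimple layers glued by linear forms -/

section TwoLayers

variable {K : Type u} [Field K] {V : Type v} [Quiver.{w} V] [Fintype V]
  {I : Ideal (PathAlgebra K V)} [I.IsTwoSided] (hI : IsAdmissible I)

/-- The linear forms on `A` which are derivations from the vertex `i` to the vertex `j`; they
correspond to the extensions of the simple module `S_i` by the simple module `S_j`. -/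
def arrowForms (i j : V) : Submodule K (QuotAlg I →ₗ[K] K) where
  carrier := {D | ∀ x y, D (x * y) = vertexCoeff hI j x * D y + D x * vertexCoeff hI i y}
  zero_mem' x y := by simp
  add_mem' {D D'} h h' x y := by
    rw [LinearMap.add_apply, h x y, h' x y, LinearMap.add_apply, LinearMap.add_apply]
    ring
  smul_mem' c D h x y := by
    rw [LinearMap.smul_apply, h x y, LinearMap.smul_apply, LinearMap.smul_apply, smul_eq_mul,
      smul_eq_mul, smul_eq_mul]
    ring

variable {hI}

theorem arrowForms_mul {i j : V} (D : arrowForms hI i j) (x y : QuotAlg I) :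
    D.1 (x * y) = vertexCoeff hI j x * D.1 y + D.1 x * vertexCoeff hI i y := D.2 x y

theorem arrowForms_one {i j : V} (D : arrowForms hI i j) : D.1 1 = 0 := by
  have h := arrowForms_mul D 1 1
  rw [mul_one, vertexCoeff_one, vertexCoeff_one, one_mul, mul_one] at h
  simpa using h

variable {Θ B : Type*} [Fintype Θ] {u : Θ → V} {w : B → V}

/-- The module with top `⨁ θ, S_(u θ)` and socle `⨁ b, S_(w b)`, glued by the forms `D θ b`. -/
def TwoLayer (_D : ∀ θ b, arrowForms hI (u θ) (w b)) : Type _ := (Θ → K) × (B → K)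

variable {D : ∀ θ b, arrowForms hI (u θ) (w b)}

instance : AddCommGroup (TwoLayer D) := inferInstanceAs (AddCommGroup ((Θ → K) × (B → K)))

instance : Module K (TwoLayer D) := inferInstanceAs (Module K ((Θ → K) × (B → K)))

instance : SMul (QuotAlg I) (TwoLayer D) :=
  ⟨fun x m => (fun θ => vertexCoeff hI (u θ) x * m.1 θ,
    fun b => vertexCoeff hI (w b) x * m.2 b + ∑ θ, (D θ b).1 x * m.1 θ)⟩

omit [Fintype Θ] in
theorem TwoLayer.ext {m m' : TwoLayer D} (h₁ : ∀ θ, m.1 θ = m'.1 θ) (h₂ : ∀ b, m.2 b = m'.2 b) :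
    m = m' := Prod.ext (funext h₁) (funext h₂)

theorem TwoLayer.smul_fst (x : QuotAlg I) (m : TwoLayer D) (θ : Θ) :
    (x • m).1 θ = vertexCoeff hI (u θ) x * m.1 θ := rfl

theorem TwoLayer.smul_snd (x : QuotAlg I) (m : TwoLayer D) (b : B) :
    (x • m).2 b = vertexCoeff hI (w b) x * m.2 b + ∑ θ, (D θ b).1 x * m.1 θ := rfl

omit [Fintype Θ] in
theorem TwoLayer.add_fst (m m' : TwoLayer D) (θ : Θ) : (m + m').1 θ = m.1 θ + m'.1 θ := rfl

omit [Fintype Θ] in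
theorem TwoLayer.add_snd (m m' : TwoLayer D) (b : B) : (m + m').2 b = m.2 b + m'.2 b := rfl

omit [Fintype Θ] in
theorem TwoLayer.zero_fst (θ : Θ) : (0 : TwoLayer D).1 θ = 0 := rfl

omit [Fintype Θ] in
theorem TwoLayer.zero_snd (b : B) : (0 : TwoLayer D).2 b = 0 := rfl

/-- Associativity of the action is the derivation rule of the forms $D$. -/
instance : Module (QuotAlg I) (TwoLayer D) where
  one_smul m := TwoLayer.ext
    (fun θ => by rw [TwoLayer.smul_fst, vertexCoeff_one, one_mul])
    (fun b => by
      rw [TwoLayer.smul_snd, vertexCoeff_one, one_mul, Finset.sum_eq_zero, add_zero]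
      exact fun θ _ => by rw [arrowForms_one, zero_mul])
  mul_smul x y m := TwoLayer.ext
    (fun θ => by
      rw [TwoLayer.smul_fst, TwoLayer.smul_fst, TwoLayer.smul_fst, vertexCoeff_mul, mul_assoc])
    (fun b => by
      simp only [TwoLayer.smul_snd, TwoLayer.smul_fst, vertexCoeff_mul, arrowForms_mul]
      rw [mul_add, Finset.mul_sum, add_assoc, ← Finset.sum_add_distrib, mul_assoc]
      congr 1
      exact Finset.sum_congr rfl fun θ _ => by ring)
  smul_zero x := TwoLayer.ext
    (fun θ => by rw [TwoLayer.smul_fst, TwoLayer.zero_fst, mul_zero])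
    (fun b => by simp [TwoLayer.smul_snd, TwoLayer.zero_fst, TwoLayer.zero_snd])
  smul_add x m m' := TwoLayer.ext
    (fun θ => by
      simp only [TwoLayer.smul_fst, TwoLayer.add_fst]
      ring)
    (fun b => by
      simp only [TwoLayer.smul_snd, TwoLayer.add_snd, TwoLayer.add_fst, mul_add,
        Finset.sum_add_distrib]
      ring)
  add_smul x y m := TwoLayer.ext
    (fun θ => by simp only [TwoLayer.smul_fst, TwoLayer.add_fst, map_add, add_mul])
    (fun b => by
      simp only [TwoLayer.smul_snd, TwoLayer.add_snd, map_add, add_mul, Finset.sum_add_distrib]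
      ring)
  zero_smul m := TwoLayer.ext
    (fun θ => by rw [TwoLayer.smul_fst, map_zero, zero_mul, TwoLayer.zero_fst])
    (fun b => by simp [TwoLayer.smul_snd, TwoLayer.zero_snd])

instance : IsScalarTower K (QuotAlg I) (TwoLayer D) :=
  ⟨fun c x m => TwoLayer.ext
    (fun θ => by
      change _ = c * (x • m).1 θ
      rw [TwoLayer.smul_fst, TwoLayer.smul_fst, map_smul, smul_eq_mul, mul_assoc])
    (fun b => by
      change _ = c * (x • m).2 b
      rw [TwoLayer.smul_snd, TwoLayer.smul_snd, map_smul, smul_eq_mul, mul_add, mul_assoc,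
        Finset.mul_sum]
      congr 1
      exact Finset.sum_congr rfl fun θ _ => by
        rw [map_smul, smul_eq_mul, mul_assoc])⟩

instance [Finite B] : Module.Finite K (TwoLayer D) :=
  inferInstanceAs (Module.Finite K ((Θ → K) × (B → K)))

theorem TwoLayer.fst_eq_zero_of_mem_radPow {l : ℕ} (hl : 1 ≤ l) {m : TwoLayer D}
    (hm : m ∈ radPow (QuotAlg I) (TwoLayer D) l) : m.1 = 0 := by
  have h1 : m ∈ radPow (QuotAlg I) (TwoLayer D) 1 := radPow_antitone hl hm
  refine Submodule.smul_induction_on h1 (fun x hx m _ => funext fun θ => ?_) fun m m' h h' => ?_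
  · rw [TwoLayer.smul_fst, (mem_jacobson_iff_vertexCoeff hI).1 hx, zero_mul, Pi.zero_apply]
  · exact (congrArg₂ (· + ·) h h').trans (add_zero 0)

theorem TwoLayer.snd_eq_zero_of_mem_radPow {l : ℕ} (hl : 2 ≤ l) {m : TwoLayer D}
    (hm : m ∈ radPow (QuotAlg I) (TwoLayer D) l) : m.2 = 0 := by
  have h1 : m ∈ radPow (QuotAlg I) (TwoLayer D) 2 := radPow_antitone hl hm
  refine Submodule.smul_induction_on h1 (fun x hx m hm => funext fun b => ?_) fun m m' h h' => ?_
  · rw [TwoLayer.smul_snd, (mem_jacobson_iff_vertexCoeff hI).1 hx, zero_mul, zero_add,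
      Pi.zero_apply]
    exact Finset.sum_eq_zero fun θ _ => by
      rw [fst_eq_zero_of_mem_radPow le_rfl hm, Pi.zero_apply, mul_zero]
  · exact (congrArg₂ (· + ·) h h').trans (add_zero 0)

end TwoLayers

/-! ### The parameter space $(D,y,c)$ -/

section Points

variable {K : Type u} [Field K] {V : Type v} [Quiver.{w} V] [Fintype V]
  {I : Ideal (PathAlgebra K V)} [I.IsTwoSided] {hI : IsAdmissible I}
  {n : ℕ} {e : Fin n → V} {Θ B : Type*} [Fintype Θ] {u : Θ → V} {w : B → V}
  {N : Type*} [AddCommGroup N] [Module (QuotAlg I) N]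

/-- The elements `p g_r` with `p z_r ∈ σ`, where `g_r` is the element `(y_r, c_r, 0)` of the direct
sum of `N` and of the module with two layers given by the forms `D`. -/
def pointFamily (σ : Finset (FreePath e)) (D : ∀ θ b, arrowForms hI (u θ) (w b)) (y : Fin n → N)
    (c : Fin n → Θ → K) (b : σ) : N × (Θ → K) × (B → K) :=
  (pathClass I b.1.path • y b.1.root,
    fun θ => vertexCoeff hI (u θ) (pathClass I b.1.path) * c b.1.root θ,
    fun β => ∑ θ, (D θ β).1 (pathClass I b.1.path) * c b.1.root θ)

/-- Only the action on a two-layer module depends on $D$, not its underlying space. So families for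
different $D$ can be compared inside one fixed vector space. -/
theorem pathFamily_eq_pointFamily (σ : Finset (FreePath e))
    (D : ∀ θ b, arrowForms hI (u θ) (w b)) (y : Fin n → N) (c : Fin n → Θ → K) :
    pathFamily I σ (fun r => ((y r, (c r, 0)) : N × TwoLayer D)) = pointFamily σ D y c := by
  ext1 b
  refine Prod.ext rfl (TwoLayer.ext (D := D) (fun θ => rfl) fun β => ?_)
  exact (congrArg (· + _) (mul_zero _)).trans (zero_add _)

variable [Module K N] [IsScalarTower K (QuotAlg I) N]

/-- The first two components are linear in $y$ and in $c$, and the third is bilinear in $(D,c)$;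
hence degree at most 2 along a line. -/
theorem pointFamily_quadratic (σ : Finset (FreePath e))
    (D D' : ∀ θ b, arrowForms hI (u θ) (w b)) (y y' : Fin n → N) (c c' : Fin n → Θ → K) :
    ∃ f₀ f₁ f₂ : σ → N × (Θ → K) × (B → K), ∀ (s : K) b,
      pointFamily σ (D + s • D') (y + s • y') (c + s • c') b =
        f₀ b + s • f₁ b + s ^ 2 • f₂ b := by
  refine ⟨pointFamily σ D y c, fun b => (pathClass I b.1.path • y' b.1.root,
    fun θ => vertexCoeff hI (u θ) (pathClass I b.1.path) * c' b.1.root θ,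
    fun β => ∑ θ, ((D θ β).1 (pathClass I b.1.path) * c' b.1.root θ +
      (D' θ β).1 (pathClass I b.1.path) * c b.1.root θ)),
    fun b => (0, 0, fun β => ∑ θ, (D' θ β).1 (pathClass I b.1.path) * c' b.1.root θ),
    fun s b => ?_⟩
  refine Prod.ext ?_ (Prod.ext (funext fun θ => ?_) (funext fun β => ?_))
  · change pathClass I b.1.path • (y b.1.root + s • y' b.1.root) =
      pathClass I b.1.path • y b.1.root + s • pathClass I b.1.path • y' b.1.root + s ^ 2 • 0
    rw [smul_add, smul_comm, smul_zero, add_zero]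
  · simp [pointFamily]
    ring
  · simp only [pointFamily, Prod.snd_add, Prod.smul_snd, Pi.add_apply, Pi.smul_apply, smul_eq_mul,
      Submodule.coe_add, Submodule.coe_smul, LinearMap.add_apply, LinearMap.smul_apply]
    rw [Finset.mul_sum, Finset.mul_sum, ← Finset.sum_add_distrib, ← Finset.sum_add_distrib]
    exact Finset.sum_congr rfl fun θ _ => by ring

end Points

/-! ### Realizing a single skeleton by a point -/

section PointOfSkeleton

theorem exists_dual_of_basis {K W ι : Type*} [Field K] [AddCommGroup W] [Module K W] {v : ι → W}
    (hv : LinearIndependent K v) (hspan : ⊤ ≤ Submodule.span K (Set.range v)) (i : ι) :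
    ∃ φ : W →ₗ[K] K, φ (v i) = 1 ∧ ∀ j, j ≠ i → φ (v j) = 0 :=
  ⟨(Module.Basis.mk hv hspan).coord i, Module.Basis.mk_coord_apply_eq i,
    fun _ hj => Module.Basis.mk_coord_apply_ne hj⟩

theorem linearIndependent_of_dual {K W ι : Type*} [Field K] [AddCommGroup W] [Module K W]
    [Finite ι] {f : ι → W}
    (h : ∀ i, ∃ φ : W →ₗ[K] K, φ (f i) = 1 ∧ ∀ j, j ≠ i → φ (f j) = 0) :
    LinearIndependent K f := by
  have := Fintype.ofFinite ι
  refine Fintype.linearIndependent_iff.2 fun g hg i => ?_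
  obtain ⟨φ, h1, h0⟩ := h i
  have h2 := congrArg φ hg
  rw [map_sum, map_zero, Finset.sum_eq_single i, map_smul, h1, smul_eq_mul, mul_one] at h2
  · exact h2
  · exact fun j _ hj => by rw [map_smul, h0 j hj, smul_zero]
  · exact fun h => absurd (Finset.mem_univ i) h

variable {K : Type u} [Field K] {V : Type v} [Quiver.{w} V] [Fintype V]
  {I : Ideal (PathAlgebra K V)} [I.IsTwoSided] {hI : IsAdmissible I}

theorem vertexCoeff_pathClass_of_length_eq_zero {n : ℕ} {e : Fin n → V} {b : FreePath e}
    (h : b.length = 0) : vertexCoeff hI b.target (pathClass I b.path) = 1 := by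
  rw [FreePath.eq_top_of_length_eq_zero h]
  exact vertexCoeff_vertexIdem_self hI _

theorem lowCoeff_pathClass_self {a b : V} (p : Quiver.Path a b) (hp : p.length < 2) :
    lowCoeff hI p hp (pathClass I p) = 1 := PathAlgebra.coeffₗ_ofPath_self p

theorem lowCoeff_pathClass_of_ne {n : ℕ} {e : Fin n → V} {b c : FreePath e}
    (hb : b.path.length < 2) (hroot : b.root = c.root) (h : c ≠ b) :
    lowCoeff hI b.path hb (pathClass I c.path) = 0 := by
  refine PathAlgebra.coeffₗ_ofPath_of_ne _ _ fun h' => h ?_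
  obtain ⟨r, j, p⟩ := b
  obtain ⟨s, k, q⟩ := c
  obtain rfl : r = s := hroot
  obtain rfl : k = j := congrArg (fun z : AnyPath V => z.2.1) h'
  have hpq : q = p := by
    have h1 := eq_of_heq (Sigma.mk.inj h').2
    exact eq_of_heq (Sigma.mk.inj h1).2
  rw [hpq]

variable {n : ℕ} {e : Fin n → V} {Ξ Θ B : Type*} [Fintype Θ] {u : Θ → V} {w : B → V}
  {Q : Ξ → Type*} [∀ ξ, AddCommGroup (Q ξ)] [∀ ξ, Module (QuotAlg I) (Q ξ)]

/-- The elements of `(⨁ ξ, Q ξ) ⊕ K^Θ ⊕ K^B` which are of degree at least `l` with respect to the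
radical filtrations of the `Q ξ`, the space `K^Θ` being of degree `0` and `K^B` of degree `1`. -/
def HasDegreeGE (I : Ideal (PathAlgebra K V)) [I.IsTwoSided] {Ξ Θ B : Type*} {Q : Ξ → Type*}
    [∀ ξ, AddCommGroup (Q ξ)] [∀ ξ, Module (QuotAlg I) (Q ξ)] (l : ℕ)
    (m : (∀ ξ, Q ξ) × (Θ → K) × (B → K)) : Prop :=
  (∀ ξ, m.1 ξ ∈ radPow (QuotAlg I) (Q ξ) l) ∧ (1 ≤ l → m.2.1 = 0) ∧ (2 ≤ l → m.2.2 = 0)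

/-- The degree condition does not mention $D$, so this bounds $J^lM$ uniformly over all points of
the parameter space. -/
theorem hasDegreeGE_of_mem_radPow {D : ∀ θ b, arrowForms hI (u θ) (w b)} {l : ℕ}
    {m : (∀ ξ, Q ξ) × TwoLayer D} (hm : m ∈ radPow (QuotAlg I) ((∀ ξ, Q ξ) × TwoLayer D) l) :
    HasDegreeGE I l (show (∀ ξ, Q ξ) × (Θ → K) × (B → K) from m) := by
  have h2 : m.2 ∈ radPow (QuotAlg I) (TwoLayer D) l :=
    map_radPow_le (LinearMap.snd (QuotAlg I) (∀ ξ, Q ξ) (TwoLayer D)) l ⟨m, hm, rfl⟩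
  refine ⟨fun ξ => ?_, fun hl => TwoLayer.fst_eq_zero_of_mem_radPow hl h2,
    fun hl => TwoLayer.snd_eq_zero_of_mem_radPow hl h2⟩
  exact map_radPow_le (LinearMap.proj ξ ∘ₗ
    LinearMap.fst (QuotAlg I) (∀ ξ, Q ξ) (TwoLayer D)) l ⟨m, hm, rfl⟩

variable [∀ ξ, Module K (Q ξ)]
  [∀ ξ, IsScalarTower K (QuotAlg I) (Q ξ)] {τ : Finset (FreePath e)} {Y : Finset (Fin n)}

section AdaptedBasis

variable {f : τ → (∀ ξ, Q ξ) × (Θ → K) × (B → K)} {E : Y ≃ Ξ} {F₀ : RestPath τ Y 0 ≃ Θ}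
  {F₁ : RestPath τ Y 1 ≃ B} {x : ∀ r : Y, Q (E r)} [DecidableEq Ξ] [DecidableEq Θ] [DecidableEq B]
  (hspan : ∀ (r : Y) l, (radPow (QuotAlg I) (Q (E r)) l).restrictScalars K =
    Submodule.span K (pathFamily I (tree τ r) (fun _ => x r) '' {b | l ≤ b.1.length}))
  (htree : ∀ (r : Y) (b : τ), b.1.root = r →
    f b = (Pi.single (E r) (pathClass I b.1.path • x r), 0, 0))
  (hzero : ∀ b : RestPath τ Y 0, f ⟨b.1, b.2.1⟩ = (0, Pi.single (F₀ b) 1, 0))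
  (hone : ∀ b : RestPath τ Y 1, f ⟨b.1, b.2.1⟩ = (0, 0, Pi.single (F₁ b) 1))

-- Paths of different kinds have images in different summands: projectives, $K^\Theta$ and $K^B$.
-- Dual functionals are therefore built on each summand and extended by zero.
include hspan htree hzero hone in
omit [Fintype Θ] in
theorem linearIndependent_of_trees (hshort : ∀ b ∈ τ, b.root ∉ Y → b.length ≤ 1)
    (hli : ∀ r : Y, LinearIndependent K (pathFamily I (tree τ r) (fun _ => x r))) :
    LinearIndependent K f := by
  have hcases : ∀ b : τ, (∃ r : Y, b.1.root = r) ∨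
      (∃ b₀ : RestPath τ Y 0, b = ⟨b₀.1, b₀.2.1⟩) ∨
      (∃ b₁ : RestPath τ Y 1, b = ⟨b₁.1, b₁.2.1⟩) := by
    intro b
    by_cases h : b.1.root ∈ Y
    · exact Or.inl ⟨⟨_, h⟩, rfl⟩
    · have h1 := hshort b.1 b.2 h
      rcases Nat.eq_zero_or_pos b.1.length with h0 | h0
      · exact Or.inr (Or.inl ⟨⟨b.1, b.2, h, h0⟩, rfl⟩)
      · exact Or.inr (Or.inr ⟨⟨b.1, b.2, h, by omega⟩, rfl⟩)
  refine linearIndependent_of_dual fun b => ?_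
  rcases hcases b with ⟨r, hr⟩ | ⟨b, rfl⟩ | ⟨b, rfl⟩
  · have htop : ⊤ ≤ Submodule.span K
        (Set.range (pathFamily I (tree τ r) (fun _ => x r))) := by
      have h0 := hspan r 0
      rw [show {b : tree τ r | 0 ≤ b.1.length} = Set.univ from
        Set.eq_univ_of_forall fun _ => Nat.zero_le _, Set.image_univ] at h0
      intro z _
      rw [← h0]
      trivial
    have hmem : ∀ b' : τ, b'.1.root = r → b'.1 ∈ tree τ r := fun b' h =>
      Finset.mem_filter.2 ⟨b'.2, h⟩
    obtain ⟨ψ, hψ1, hψ0⟩ := exists_dual_of_basis (hli r) htop ⟨b.1, hmem b hr⟩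
    refine ⟨ψ ∘ₗ LinearMap.proj (E r) ∘ₗ LinearMap.fst K _ _, ?_, fun b' hb' => ?_⟩
    · rw [LinearMap.comp_apply, LinearMap.comp_apply, LinearMap.fst_apply, LinearMap.proj_apply,
        htree r b hr]
      dsimp only
      rw [Pi.single_eq_same]
      exact hψ1
    · rw [LinearMap.comp_apply, LinearMap.comp_apply, LinearMap.fst_apply, LinearMap.proj_apply]
      rcases hcases b' with ⟨r', hr'⟩ | ⟨b', rfl⟩ | ⟨b', rfl⟩
      · rw [htree r' b' hr']
        by_cases hrr : r = r'
        · subst hrr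
          dsimp only
          rw [Pi.single_eq_same]
          exact hψ0 ⟨b'.1, hmem b' hr'⟩
            fun h => hb' (Subtype.ext (congrArg (fun z : tree τ r => z.1) h))
        · dsimp only
          rw [Pi.single_eq_of_ne (fun h => hrr (E.injective h)), map_zero]
      · rw [hzero]
        exact map_zero ψ
      · rw [hone]
        exact map_zero ψ
  · refine ⟨LinearMap.proj (F₀ b) ∘ₗ LinearMap.fst K _ _ ∘ₗ LinearMap.snd K _ _, ?_,
      fun b' hb' => ?_⟩
    · rw [hzero]
      exact Pi.single_eq_same (M := fun _ => K) (F₀ b) 1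
    · change (f b').2.1 (F₀ b) = 0
      rcases hcases b' with ⟨r', hr'⟩ | ⟨b', rfl⟩ | ⟨b', rfl⟩
      · rw [htree r' b' hr']
        rfl
      · rw [hzero]
        refine Pi.single_eq_of_ne (M := fun _ => K) (fun h => hb' ?_) 1
        rw [F₀.injective h]
      · rw [hone]
        rfl
  · refine ⟨LinearMap.proj (F₁ b) ∘ₗ LinearMap.snd K _ _ ∘ₗ LinearMap.snd K _ _, ?_,
      fun b' hb' => ?_⟩
    · rw [hone]
      exact Pi.single_eq_same (M := fun _ => K) (F₁ b) 1
    · change (f b').2.2 (F₁ b) = 0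
      rcases hcases b' with ⟨r', hr'⟩ | ⟨b', rfl⟩ | ⟨b', rfl⟩
      · rw [htree r' b' hr']
        rfl
      · rw [hzero]
        rfl
      · rw [hone]
        refine Pi.single_eq_of_ne (M := fun _ => K) (fun h => hb' ?_) 1
        rw [F₁.injective h]

include hspan htree hzero hone in
theorem mem_span_of_hasDegreeGE [Finite Ξ] [Finite B] (l : ℕ)
    (m : (∀ ξ, Q ξ) × (Θ → K) × (B → K)) (hm : HasDegreeGE I l m) :
    m ∈ Submodule.span K (f '' {b | l ≤ b.1.length}) := by
  have := Fintype.ofFinite Ξ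
  have := Fintype.ofFinite B
  set S := Submodule.span K (f '' {b | l ≤ b.1.length})
  obtain ⟨m, t, s⟩ := m
  obtain ⟨hm, ht, hs⟩ := hm
  have h1 : ∀ ξ, ((Pi.single ξ (m ξ), 0, 0) : (∀ ξ, Q ξ) × (Θ → K) × (B → K)) ∈ S := by
    intro ξ
    obtain ⟨r, rfl⟩ := E.surjective ξ
    have h2 : m (E r) ∈ (radPow (QuotAlg I) (Q (E r)) l).restrictScalars K := hm (E r)
    rw [hspan] at h2
    let ι : Q (E r) →ₗ[K] (∀ ξ, Q ξ) × (Θ → K) × (B → K) :=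
      LinearMap.inl K _ _ ∘ₗ LinearMap.single K Q (E r)
    have h3 : (Submodule.span K
        (pathFamily I (tree τ r) (fun _ => x r) '' {b | l ≤ b.1.length})).map ι ≤ S := by
      rw [Submodule.map_span, Submodule.span_le]
      rintro _ ⟨_, ⟨b, hb, rfl⟩, rfl⟩
      refine Submodule.subset_span ⟨⟨b.1, (Finset.mem_filter.1 b.2).1⟩, hb, ?_⟩
      exact htree r _ (root_of_mem_tree b.2)
    exact h3 ⟨m (E r), h2, rfl⟩
  have h2 : ∀ θ, ((0, Pi.single θ (t θ), 0) : (∀ ξ, Q ξ) × (Θ → K) × (B → K)) ∈ S := by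
    intro θ
    rcases Nat.eq_zero_or_pos l with hl | hl
    · have h3 : ((0, Pi.single θ (t θ), 0) : (∀ ξ, Q ξ) × (Θ → K) × (B → K)) =
          t θ • f ⟨(F₀.symm θ).1, (F₀.symm θ).2.1⟩ := by
        rw [hzero, F₀.apply_symm_apply, Prod.smul_mk, Prod.smul_mk, smul_zero, smul_zero,
          ← Pi.single_smul, smul_eq_mul, mul_one]
      rw [h3]
      refine Submodule.smul_mem _ _ (Submodule.subset_span ⟨_, ?_, rfl⟩)
      exact (hl.trans_le (Nat.zero_le _))
    · have h3 : t θ = 0 := congrFun (ht hl) θ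
      rw [h3, Pi.single_zero]
      exact zero_mem S
  have h3 : ∀ β, ((0, 0, Pi.single β (s β)) : (∀ ξ, Q ξ) × (Θ → K) × (B → K)) ∈ S := by
    intro β
    rcases Nat.lt_or_ge l 2 with hl | hl
    · have h3 : ((0, 0, Pi.single β (s β)) : (∀ ξ, Q ξ) × (Θ → K) × (B → K)) =
          s β • f ⟨(F₁.symm β).1, (F₁.symm β).2.1⟩ := by
        rw [hone, F₁.apply_symm_apply, Prod.smul_mk, Prod.smul_mk, smul_zero, smul_zero,
          ← Pi.single_smul, smul_eq_mul, mul_one]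
      rw [h3]
      refine Submodule.smul_mem _ _ (Submodule.subset_span ⟨_, ?_, rfl⟩)
      exact (Nat.le_of_lt_succ hl).trans (F₁.symm β).2.2.2.ge
    · have h3 : s β = 0 := congrFun (hs hl) β
      rw [h3, Pi.single_zero]
      exact zero_mem S
  have hsum : ((m, t, s) : (∀ ξ, Q ξ) × (Θ → K) × (B → K)) =
      ∑ ξ, (Pi.single ξ (m ξ), 0, 0) + ∑ θ, (0, Pi.single θ (t θ), 0) +
        ∑ β, (0, 0, Pi.single β (s β)) := by
    refine Prod.ext ?_ (Prod.ext ?_ ?_)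
    · simp [Prod.fst_sum, Finset.univ_sum_single]
    · simp [Prod.fst_sum, Prod.snd_sum, Finset.univ_sum_single]
    · simp [Prod.snd_sum, Finset.univ_sum_single]
  rw [hsum]
  exact add_mem (add_mem (sum_mem fun ξ _ => h1 ξ) (sum_mem fun θ _ => h2 θ))
    (sum_mem fun β _ => h3 β)

end AdaptedBasis

/-- A set of paths whose trees with root in `Y` yield adapted bases of the modules `Q ξ`, and whose
remaining paths have length at most `1`, is realized by a point, in such a way that the resulting
basis is adapted to the filtration by degree. -/
theorem exists_point [Finite Ξ] [Finite B]
    (hinit : ∀ (r : Fin n) (j k : V) (p₁ : Quiver.Path (e r) j) (p₂ : Quiver.Path j k),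
      (⟨r, k, p₁.comp p₂⟩ : FreePath e) ∈ τ → (⟨r, j, p₁⟩ : FreePath e) ∈ τ)
    (hshort : ∀ b ∈ τ, b.root ∉ Y → b.length ≤ 1)
    (E : Y ≃ Ξ) (F₀ : RestPath τ Y 0 ≃ Θ) (hF₀ : ∀ b, u (F₀ b) = b.1.target)
    (F₁ : RestPath τ Y 1 ≃ B) (hF₁ : ∀ b, w (F₁ b) = b.1.target)
    (hQ : ∀ r : Y, ∃ x : Q (E r),
      LinearIndependent K (pathFamily I (tree τ r) (fun _ => x)) ∧
      ∀ l, (radPow (QuotAlg I) (Q (E r)) l).restrictScalars K =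
        Submodule.span K (pathFamily I (tree τ r) (fun _ => x) '' {b | l ≤ b.1.length})) :
    ∃ (D : ∀ θ b, arrowForms hI (u θ) (w b)) (y : Fin n → ∀ ξ, Q ξ) (c : Fin n → Θ → K),
      LinearIndependent K (pointFamily τ D y c) ∧
      ∀ l m, HasDegreeGE I l m →
        m ∈ Submodule.span K (pointFamily τ D y c '' {b | l ≤ b.1.length}) := by
  classical
  have := Fintype.ofFinite Ξ
  have := Fintype.ofFinite B
  have hroot₀ : ∀ b b' : RestPath τ Y 0, b.1.root = b'.1.root → b = b' := fun b b' h =>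
    Subtype.ext (by
      rw [FreePath.eq_top_of_length_eq_zero b.2.2.2, FreePath.eq_top_of_length_eq_zero b'.2.2.2, h])
  have hlt : ∀ b : RestPath τ Y 1, b.1.path.length < 2 := fun b => by
    have : b.1.path.length = 1 := b.2.2.2
    omega
  -- The form gluing $\theta$ to $\beta$ reads off the coefficient of the length 1 path belonging to
  -- $\beta$ if that path grows from the root belonging to $\theta$, and is 0 otherwise.
  have hD : ∀ θ β, ∃ D : arrowForms hI (u θ) (w β), ∀ a, D.1 a =
      if (F₁.symm β).1.root = (F₀.symm θ).1.root then
        lowCoeff hI (F₁.symm β).1.path (hlt _) a else 0 := by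
    intro θ β
    by_cases h : (F₁.symm β).1.root = (F₀.symm θ).1.root
    · refine ⟨⟨lowCoeff hI (F₁.symm β).1.path (hlt _), fun a a' => ?_⟩, fun a => by rw [if_pos h]⟩
      have hu : u θ = e (F₁.symm β).1.root := by
        rw [← F₀.apply_symm_apply θ, hF₀, h]
        exact congrArg FreePath.target (FreePath.eq_top_of_length_eq_zero (F₀.symm θ).2.2.2)
      have hw : w β = (F₁.symm β).1.target := by
        rw [← hF₁, F₁.apply_symm_apply]
      rw [hu, hw]
      exact lowCoeff_mul hI (F₁.symm β).1.path (F₁.symm β).2.2.2 a a'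
    · exact ⟨0, fun a => by rw [if_neg h]; rfl⟩
  choose D hD using hD
  choose x hli hspan using hQ
  -- A root in $Y$ goes to the generator of its own summand, any other root in the skeleton to its
  -- own basis vector of $K^\Theta$, and the unused $z_r$ outside $Y$ to 0.
  let y : Fin n → ∀ ξ, Q ξ := fun r => if h : r ∈ Y then Pi.single (E ⟨r, h⟩) (x ⟨r, h⟩) else 0
  let c : Fin n → Θ → K := fun r θ => if (F₀.symm θ).1.root = r then 1 else 0
  have hc : ∀ r θ, c r θ = if (F₀.symm θ).1.root = r then 1 else 0 := fun _ _ => rfl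
  have hy : ∀ r : Y, y r = Pi.single (E r) (x r) := fun r => dif_pos r.2
  have hy0 : ∀ r, r ∉ Y → y r = 0 := fun r hr => dif_neg hr
  have hc0 : ∀ r, r ∈ Y → c r = 0 := fun r hr => funext fun θ =>
    if_neg fun h : (F₀.symm θ).1.root = r => (F₀.symm θ).2.2.1 (by rw [h]; exact hr)
  have htree : ∀ (r : Y) (b : τ), b.1.root = r →
      pointFamily τ D y c b = (Pi.single (E r) (pathClass I b.1.path • x r), 0, 0) := by
    intro r b hb
    have h1 : y b.1.root = Pi.single (E r) (x r) := by rw [hb, hy]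
    have h2 : c b.1.root = 0 := by rw [hb]; exact hc0 _ r.2
    rw [pointFamily, h1, h2, ← Pi.single_smul]
    refine Prod.ext rfl (Prod.ext (funext fun θ => ?_) (funext fun β => ?_))
    · exact mul_zero _
    · exact Finset.sum_eq_zero fun θ _ => mul_zero _
  have hzero : ∀ b : RestPath τ Y 0,
      pointFamily τ D y c ⟨b.1, b.2.1⟩ = (0, Pi.single (F₀ b) 1, 0) := by
    intro b
    refine Prod.ext ?_ (Prod.ext (funext fun θ => ?_) (funext fun β => ?_))
    · change pathClass I b.1.path • y b.1.root = 0
      rw [hy0 _ b.2.2.1, smul_zero]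
    · change vertexCoeff hI (u θ) (pathClass I b.1.path) * (if _ then 1 else 0) =
        (Pi.single (F₀ b) 1 : Θ → K) θ
      by_cases h : θ = F₀ b
      · rw [h, F₀.symm_apply_apply, if_pos rfl, Pi.single_eq_same, mul_one, hF₀,
          vertexCoeff_pathClass_of_length_eq_zero b.2.2.2]
      · rw [Pi.single_eq_of_ne h, if_neg, mul_zero]
        exact fun h' => h (by rw [← hroot₀ _ _ h', F₀.apply_symm_apply])
    · change ∑ θ, (D θ β).1 (pathClass I b.1.path) * c b.1.root θ = 0
      refine Finset.sum_eq_zero fun θ _ => ?_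
      rw [hD, hc]
      split_ifs with h1 h2
      · rw [lowCoeff_pathClass_of_ne (hlt _) (h1.trans h2), zero_mul]
        intro h3
        have h4 := (F₁.symm β).2.2.2
        rw [← h3, b.2.2.2] at h4
        omega
      all_goals simp
  have hone : ∀ b : RestPath τ Y 1,
      pointFamily τ D y c ⟨b.1, b.2.1⟩ = (0, 0, Pi.single (F₁ b) 1) := by
    intro b
    refine Prod.ext ?_ (Prod.ext (funext fun θ => ?_) (funext fun β => ?_))
    · change pathClass I b.1.path • y b.1.root = 0
      rw [hy0 _ b.2.2.1, smul_zero]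
    · change vertexCoeff hI (u θ) (pathClass I b.1.path) * _ = 0
      have hpos : 0 < b.1.path.length := by
        have : b.1.path.length = 1 := b.2.2.2
        omega
      rw [vertexCoeff_pathClass_of_pos hI _ _ hpos, zero_mul]
    · change ∑ θ, (D θ β).1 (pathClass I b.1.path) * c b.1.root θ =
        (Pi.single (F₁ b) 1 : B → K) β
      have htop : FreePath.top e b.1.root ∈ τ :=
        hinit b.1.root _ b.1.target Quiver.Path.nil b.1.path
          (by rw [Quiver.Path.nil_comp]; exact b.2.1)
      -- The root of $b$ belongs to the skeleton by closure under initial subpaths; its index is the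
      -- only one that contributes to the sum over $\theta$.
      let t : RestPath τ Y 0 := ⟨FreePath.top e b.1.root, htop, b.2.2.1, rfl⟩
      rw [Finset.sum_eq_single (F₀ t)]
      · rw [hc, F₀.symm_apply_apply, if_pos (show t.1.root = b.1.root from rfl), mul_one, hD, F₀.symm_apply_apply]
        by_cases h : β = F₁ b
        · obtain rfl : b = F₁.symm β := by rw [h, F₁.symm_apply_apply]
          rw [F₁.apply_symm_apply, Pi.single_eq_same, if_pos (by rfl), lowCoeff_pathClass_self]
        · rw [Pi.single_eq_of_ne h]
          split_ifs with h1
          · refine lowCoeff_pathClass_of_ne (hlt _) h1 fun h2 => h ?_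
            rw [show b = F₁.symm β from Subtype.ext h2, F₁.apply_symm_apply]
          · rfl
      · intro θ _ hθ
        rw [hc, if_neg, mul_zero]
        exact fun h => hθ (by rw [← hroot₀ (F₀.symm θ) t h, F₀.apply_symm_apply])
      · exact fun h => absurd (Finset.mem_univ _) h
  exact ⟨D, y, c, linearIndependent_of_trees hspan htree hzero hone hshort hli,
    mem_span_of_hasDegreeGE hspan htree hzero hone⟩

end PointOfSkeleton

/-! ### From a module with an adapted basis to a point of the Grassmannian -/

section Grass

variable {K : Type u} [Field K] {V : Type v} [Quiver.{w} V] [Fintype V]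
  {I : Ideal (PathAlgebra K V)} [I.IsTwoSided] {n : ℕ} {e : Fin n → V}

variable (I) in
/-- The `A`-linear map from `P` to an `A`-module which sends `p z_r` to `p x_r`. -/
def liftBigP {M : Type*} [AddCommGroup M] [Module (QuotAlg I) M] (e : Fin n → V) (x : Fin n → M) :
    BigP I e →ₗ[QuotAlg I] M where
  toFun p := ∑ r, (p r : QuotAlg I) • x r
  map_add' p q := by
    rw [← Finset.sum_add_distrib]
    exact Finset.sum_congr rfl fun r _ => by
      rw [Pi.add_apply, Submodule.coe_add, add_smul]
  map_smul' a p := by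
    rw [RingHom.id_apply, Finset.smul_sum]
    exact Finset.sum_congr rfl fun r _ => by
      rw [Pi.smul_apply, Submodule.coe_smul, smul_eq_mul, mul_smul]

theorem vertexIdem_smul_z (r : Fin n) : vertexIdem I (e r) • BigP.z I e r = BigP.z I e r := by
  rw [BigP.z, ProjSum.z, ← Pi.single_smul]
  congr 1
  exact Subtype.ext (vertexIdem_mul_self _)

variable {M : Type*} [AddCommGroup M] [Module (QuotAlg I) M]

theorem liftBigP_z (x : Fin n → M) (r : Fin n) :
    liftBigP I e x (BigP.z I e r) = vertexIdem I (e r) • x r := by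
  change ∑ s, (BigP.z I e r s : QuotAlg I) • x s = _
  rw [Finset.sum_eq_single r]
  · rw [BigP.z, ProjSum.z, Pi.single_eq_same]
  · intro s _ hs
    rw [BigP.z, ProjSum.z, Pi.single_eq_of_ne hs, Submodule.coe_zero, zero_smul]
  · simp

theorem pathFamily_map {N : Type*} [AddCommGroup N] [Module (QuotAlg I) N]
    (f : N →ₗ[QuotAlg I] M) (σ : Finset (FreePath e)) (x : Fin n → N) :
    pathFamily I σ (fun r => f (x r)) = f ∘ pathFamily I σ x :=
  funext fun _ => (map_smul f _ _).symm

theorem pathFamily_vertexIdem_smul (σ : Finset (FreePath e)) (x : Fin n → M) :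
    pathFamily I σ (fun r => vertexIdem I (e r) • x r) = pathFamily I σ x := by
  ext1 b
  rw [pathFamily_apply, pathFamily_apply, ← mul_smul, pathClass_mul_vertexIdem]

variable [DecidableEq V] [Module K M] [IsScalarTower K (QuotAlg I) M]

/-- If the elements `p x_r` with `p z_r ∈ σ` form a basis of an `A`-module `M` whose radical
filtration is no larger than `σ` predicts, then the kernel of the map `P → M` which sends `z_r` to
the component of `x_r` at `e r` is a point of `GRASS(σ)`. -/
theorem ker_liftBigP_mem_grass (hI : IsAdmissible I) [Module.Finite K M]
    {σ : Finset (FreePath e)} (hσ : IsSkeleton I σ) {x : Fin n → M}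
    (hli : LinearIndependent K (pathFamily I σ x))
    (hcard : Fintype.card σ = Module.finrank K M)
    (hdim : ∀ l, Module.finrank K (radPow (QuotAlg I) M l) ≤
      Nat.card {b : σ // l ≤ b.1.length}) :
    LinearMap.ker (liftBigP I e x) ∈ grass I σ := by
  have hspan : Submodule.span K (Set.range (pathFamily I σ x)) = ⊤ :=
    hli.span_eq_top_of_card_eq_finrank' hcard
  set g := liftBigP I e x
  set C := LinearMap.ker g
  -- Replacing $x_r$ by its component $e_{e(r)}x_r$ changes nothing, because each path starting at
  -- $e(r)$ absorbs that idempotent.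
  have hgz : pathFamily I σ (fun r => g (BigP.z I e r)) = pathFamily I σ x := by
    rw [← pathFamily_vertexIdem_smul σ x]
    congr 1
    exact funext fun r => liftBigP_z x r
  have hsurj : Function.Surjective g := by
    have h1 : LinearMap.range (g.restrictScalars K) = ⊤ := by
      rw [eq_top_iff, ← hspan, Submodule.span_le]
      rintro _ ⟨b, rfl⟩
      rw [← hgz, pathFamily_map]
      exact ⟨_, rfl⟩
    exact (LinearMap.range_eq_top (f := g.restrictScalars K)).1 h1
  let ψ : (BigP I e ⧸ C) ≃ₗ[QuotAlg I] M := g.quotKerEquivOfSurjective hsurj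
  let ψK : (BigP I e ⧸ C) ≃ₗ[K] M := ψ.restrictScalars K
  have hfin : Module.Finite K (BigP I e ⧸ C) := Module.Finite.equiv ψK.symm
  have hψ : ψ.toLinearMap ∘ pathFamily I σ (fun r => C.mkQ (BigP.z I e r)) =
      pathFamily I σ x := by
    rw [← hgz, ← pathFamily_map]
    rfl
  have hli' : LinearIndependent K (pathFamily I σ (fun r => C.mkQ (BigP.z I e r))) := by
    refine LinearIndependent.of_comp ψK.toLinearMap ?_
    rw [← hψ] at hli
    exact hli
  have htop : Submodule.span K
      (Set.range (pathFamily I σ (fun r => C.mkQ (BigP.z I e r)))) = ⊤ :=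
    hli'.span_eq_top_of_card_eq_finrank' (by rw [hcard, ψK.finrank_eq])
  have hdim' : ∀ l, Module.finrank K (radPow (QuotAlg I) (BigP I e ⧸ C) l) ≤
      Nat.card {b : σ // l ≤ b.1.length} := by
    intro l
    refine le_trans (le_of_eq ?_) (hdim l)
    have h1 := map_radPow ψ.surjective (f := ψ.toLinearMap) l
    have h2 : ((radPow (QuotAlg I) (BigP I e ⧸ C) l).restrictScalars K).map ψK.toLinearMap =
        (radPow (QuotAlg I) M l).restrictScalars K := by
      rw [← h1]
      rfl
    exact (LinearEquiv.finrank_map_eq ψK _).symm.trans (by rw [h2])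
  have hrel := isSkeletonRel_of_pathFamily hI (x := fun r => C.mkQ (BigP.z I e r))
    (fun r => by rw [← map_smul, vertexIdem_smul_z]) hli' htop hdim'
  refine ⟨⟨fun i => ?_, hrel.layering⟩, hrel⟩
  rw [dimVec_eq_of_pathFamily hli' htop, hσ.dim_eq]

end Grass

/-! ### A point common to both skeleta -/

section CommonPoint

variable {K : Type u} [Field K] {V : Type v} [Quiver.{w} V] [Fintype V]
  {I : Ideal (PathAlgebra K V)} [I.IsTwoSided] {hI : IsAdmissible I} {n : ℕ} {e : Fin n → V}

theorem finrank_le_card_of_le_span {W ι : Type*} [AddCommGroup W] [Module K W] [Finite ι]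
    {v : ι → W} {p : ι → Prop} {S : Submodule K W} (hS : S ≤ Submodule.span K (v '' {b | p b})) :
    Module.finrank K S ≤ Nat.card {b // p b} := by
  have := Fintype.ofFinite {b // p b}
  have h : v '' {b | p b} = Set.range fun b : {b // p b} => v b := by
    ext; simp
  rw [h] at hS
  have : Module.Finite K (Submodule.span K (Set.range fun b : {b // p b} => v b)) :=
    Module.Finite.span_of_finite K (Set.finite_range _)
  rw [Nat.card_eq_fintype_card]
  exact (Submodule.finrank_mono hS).trans (finrank_range_le_card _)

/-- If two sets of paths are each realized as a basis by some point, then they are both realized by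
a single point, since the condition is open on the line through the two points. -/
theorem exists_common_point [Infinite K] {Θ B N : Type*} [Fintype Θ] {u : Θ → V}
    {w : B → V} [AddCommGroup N] [Module (QuotAlg I) N] [Module K N]
    [IsScalarTower K (QuotAlg I) N] [Module.Finite K (N × (Θ → K) × (B → K))]
    {σ τ : Finset (FreePath e)}
    (hσ : Fintype.card σ = Module.finrank K (N × (Θ → K) × (B → K)))
    (hτ : Fintype.card τ = Module.finrank K (N × (Θ → K) × (B → K)))
    {D D' : ∀ θ b, arrowForms hI (u θ) (w b)} {y y' : Fin n → N} {c c' : Fin n → Θ → K}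
    (h : LinearIndependent K (pointFamily σ D y c))
    (h' : LinearIndependent K (pointFamily τ D' y' c')) :
    ∃ (D : ∀ θ b, arrowForms hI (u θ) (w b)) (y : Fin n → N) (c : Fin n → Θ → K),
      LinearIndependent K (pointFamily σ D y c) ∧ LinearIndependent K (pointFamily τ D y c) := by
  obtain ⟨f₀, f₁, f₂, hf⟩ := pointFamily_quadratic σ D (D' - D) y (y' - y) c (c' - c)
  obtain ⟨g₀, g₁, g₂, hg⟩ := pointFamily_quadratic τ D (D' - D) y (y' - y) c (c' - c)
  have hD : D + (D' - D) = D' := funext fun θ => funext fun b => add_sub_cancel (D θ b) (D' θ b)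
  -- The line passes through the point of $\sigma$ at $s=0$ and through that of $\tau$ at $s=1$, so
  -- each exceptional set is finite.
  have h1 := finite_setOf_not_linearIndependent hσ f₀ f₁ f₂ hf (s₀ := 0) (by simpa using h)
  have h2 := finite_setOf_not_linearIndependent hτ g₀ g₁ g₂ hg (s₀ := 1)
    (by rwa [one_smul, one_smul, one_smul, hD, add_sub_cancel, add_sub_cancel])
  obtain ⟨s, hs⟩ := (h1.union h2).exists_notMem
  simp only [Set.mem_union, Set.mem_ofPred_eq, not_or, not_not] at hs
  exact ⟨_, _, _, hs.1, hs.2⟩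

variable [DecidableEq V] {σ τ : Finset (FreePath e)} {X Y : Finset (Fin n)}

/-- The conclusion of `exists_generator_of_tree` for a root of a normal form, transported along a
bijection which preserves the vertices of the roots. -/
theorem NormalForm.exists_generator (hI : IsAdmissible I) (hτ : NormalForm I τ Y) (E : Y ≃ X)
    (hE : ∀ r, e (E r) = e r) (r : Y) : ∃ x : IndecProj I (e (E r)),
      LinearIndependent K (pathFamily I (tree τ r) (fun _ => x)) ∧
      ∀ l, (radPow (QuotAlg I) (IndecProj I (e (E r))) l).restrictScalars K =
        Submodule.span K (pathFamily I (tree τ r) (fun _ => x) '' {b | l ≤ b.1.length}) := by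
  rw [hE r]
  obtain ⟨x, -, hx⟩ := exists_generator_of_tree
    (radPow_eq_bot_of_loewyLength (hτ.loewy r r.2)) hI (hτ.proj r r.2)
  exact ⟨x, hx⟩

theorem NormalForm.exists_mem_grass [Infinite K] (hI : IsAdmissible I)
    (hself : Module.Injective (QuotAlg I) (QuotAlg I))
    (hJ : Ring.jacobson (QuotAlg I) ^ 3 = ⊥) (hσ : NormalForm I σ X) (hτ : NormalForm I τ Y)
    (hS : ∀ l i, layerCount σ l i = layerCount τ l i) (hσs : IsSkeleton I σ)
    (hτs : IsSkeleton I τ) : ∃ C, C ∈ grass I σ ∧ C ∈ grass I τ := by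
  obtain ⟨E, hE⟩ := hσ.exists_root_equiv hI hself hJ hτ hS
  obtain ⟨F₀, hF₀⟩ := hσ.exists_restPath_equiv hτ hS E hE 0
  obtain ⟨F₁, hF₁⟩ := hσ.exists_restPath_equiv hτ hS E hE 1
  have := Fintype.ofFinite (RestPath σ X 0)
  -- The ambient space is modelled on $\sigma$, so its own bijections are identities; $\tau$ enters
  -- the same space through $E$, $F_0$ and $F_1$.
  obtain ⟨D, y, c, hli, hdeg⟩ := exists_point (hI := hI) (Q := fun r : X => IndecProj I (e r))
    (u := fun b : RestPath σ X 0 => b.1.target) (w := fun b : RestPath σ X 1 => b.1.target)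
    hσ.initial hσ.short (Equiv.refl X) (Equiv.refl _) (fun _ => rfl) (Equiv.refl _)
    (fun _ => rfl) (hσ.exists_generator hI (Equiv.refl X) fun _ => rfl)
  obtain ⟨D', y', c', hli', hdeg'⟩ := exists_point (hI := hI)
    (Q := fun r : X => IndecProj I (e r))
    (u := fun b : RestPath σ X 0 => b.1.target) (w := fun b : RestPath σ X 1 => b.1.target)
    hτ.initial hτ.short E F₀ hF₀ F₁ hF₁ (hτ.exists_generator hI E hE)
  have htop : ∀ {ρ : Finset (FreePath e)} {f : ρ →
      (∀ r : X, IndecProj I (e r)) × (RestPath σ X 0 → K) × (RestPath σ X 1 → K)},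
      (∀ l m, HasDegreeGE I l m → m ∈ Submodule.span K (f '' {b | l ≤ b.1.length})) →
      ⊤ ≤ Submodule.span K (Set.range f) := fun hf m _ =>
    Submodule.span_mono (Set.image_subset_range _ _) (hf 0 m
      ⟨fun _ => trivial, fun h => absurd h (by omega), fun h => absurd h (by omega)⟩)
  have hcard := Module.finrank_eq_card_basis (Module.Basis.mk hli (htop hdeg))
  have hcard' := Module.finrank_eq_card_basis (Module.Basis.mk hli' (htop hdeg'))
  have hfin := Module.Finite.of_basis (Module.Basis.mk hli (htop hdeg))
  obtain ⟨D₁, y₁, c₁, h, h'⟩ := exists_common_point hcard.symm hcard'.symm hli hli'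
  let x : Fin n → (∀ r : X, IndecProj I (e r)) × TwoLayer D₁ := fun r => (y₁ r, (c₁ r, 0))
  have hx : LinearIndependent K (pathFamily I σ x) := by
    rw [pathFamily_eq_pointFamily]
    exact h
  have hx' : LinearIndependent K (pathFamily I τ x) := by
    rw [pathFamily_eq_pointFamily]
    exact h'
  have hfin₁ : Module.Finite K ((∀ r : X, IndecProj I (e r)) × TwoLayer D₁) := hfin
  -- The degree bounds come from the two original points, but remain valid for the module at the new
  -- point because degree does not involve the forms.
  refine ⟨_, ker_liftBigP_mem_grass hI hσs hx hcard.symm fun l => ?_,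
    ker_liftBigP_mem_grass hI hτs hx' hcard'.symm fun l => ?_⟩
  · exact finrank_le_card_of_le_span
      (S := (radPow (QuotAlg I) ((∀ r : X, IndecProj I (e r)) × TwoLayer D₁) l).restrictScalars K)
      fun m hm => hdeg l m (hasDegreeGE_of_mem_radPow hm)
  · exact finrank_le_card_of_le_span
      (S := (radPow (QuotAlg I) ((∀ r : X, IndecProj I (e r)) × TwoLayer D₁) l).restrictScalars K)
      fun m hm => hdeg' l m (hasDegreeGE_of_mem_radPow hm)

end CommonPoint

end SkeletonGrass

end

theorem lemma5p3 {K : Type*} [Field K] [IsAlgClosed K]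
    {V : Type*} [Quiver V] [Fintype V] [DecidableEq V] [∀ i j : V, Finite (i ⟶ j)]
    (I : Ideal (SkeletonGrass.PathAlgebra K V)) [I.IsTwoSided]
    (hI : SkeletonGrass.IsAdmissible I)
    (hself : Module.Injective (SkeletonGrass.QuotAlg I) (SkeletonGrass.QuotAlg I))
    (hJ : Ring.jacobson (SkeletonGrass.QuotAlg I) ^ 3 = ⊥)
    {n : ℕ} (e : Fin n → V) (σ τ : Finset (SkeletonGrass.FreePath e))
    (hσ : SkeletonGrass.IsSkeleton I σ) (hτ : SkeletonGrass.IsSkeleton I τ)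
    (hσn : SkeletonGrass.IsNormalized I σ) (hτn : SkeletonGrass.IsNormalized I τ)
    (hS : ∀ (l : ℕ) (i : V), SkeletonGrass.layerCount σ l i = SkeletonGrass.layerCount τ l i)
    (hσne : (SkeletonGrass.grass I σ).Nonempty) (hτne : (SkeletonGrass.grass I τ).Nonempty) :
    ∃ C ∈ SkeletonGrass.grass I σ ∩ SkeletonGrass.grass I τ,
      SkeletonGrass.IsSkeletonOf I (SkeletonGrass.BigP I e ⧸ C) σ ∧
      SkeletonGrass.IsSkeletonOf I (SkeletonGrass.BigP I e ⧸ C) τ := by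
  obtain ⟨X, hX⟩ := SkeletonGrass.exists_normalForm hI hσ hσn
  obtain ⟨Y, hY⟩ := SkeletonGrass.exists_normalForm hI hτ hτn
  obtain ⟨C, h₁, h₂⟩ := hX.exists_mem_grass hI hself hJ hY hS hσ hτ
  exact ⟨C, ⟨h₁, h₂⟩, ⟨_, h₁.2⟩, ⟨_, h₂.2⟩⟩
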